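/- **Theorem 3.1.** There is an absolute constant $C>0$ such that the following holds. Let $\mu_1,\ldots,\mu_n\in\mathbb R^d$ be fixed vectors, let $\Gamma$ be the subspace they span, and let $k=\dim\Gamma\ge 1$. For $i=1,\ldots,n$ let $m_i\ge 2$ be an integer and let $w_i,\eta_i\ge 0$ be reals. For $j=1,\ldots,m_i$ let $x_{ij}=\mu_i+z_{ij}$, where all the noise vectors $z_{ij}\in\mathbb R^d$ are independent (not necessarily identically distributed or spherical), have mean zero, and $z_{ij}$ is $\eta_i$-sub-Gaussian, meaning that $\mathbb E\big[|u^{\mathsf T}z_{ij}|^p\big]^{1/p}\le \eta_i\sqrt p$ for every unit vector $u\in\mathbb R^d$ and every real $p\ge 1$. Put $$A=\sum_{i=1}^n\frac{w_i}{m_i(m_i-1)}\sum_{j_1\ne j_2}x_{ij_1}x_{ij_2}^{\mathsf T},\qquad \xi^2=\Big\|\sum_{i=1}^n \frac{w_i^2\eta_i^2}{m_i}\,\mu_i\mu_i^{\mathsf T}\Big\|,$$ where the inner sum is over ordered pairs of distinct $j_1,j_2\in\{1,\ldots,m_i\}$ and $\|\cdot\|$ is the spectral norm, and let $\sigma_k^2$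 be the $k$-th largest eigenvalue of $\sum_{i=1}^n w_i\mu_i\mu_i^{\mathsf T}$; assume $\sigma_k^2>0$. Let $\hat\Gamma$ be the subspace spanned by top-$k$ eigenvectors of $A$ (ties broken arbitrarily), and let $\theta\in[0,\pi/2]$ be the maximum principal angle between $\hat\Gamma$ and $\Gamma$, that is, $\sin\theta=\|\Pi_{\hat\Gamma}-\Pi_\Gamma\|$ with $\Pi$ denoting orthogonal projection. Then for every $\delta\in(0,1/2)$, with probability at least $1-\delta$, $$\sin\theta\le C\left(\sigma_k^{-2}\sqrt{\big(d+\log(1/\delta)\big)\Big(\xi^2+\sum_{i=1}^n\frac{w_i^2\eta_i^4}{m_i^2}\Big)}+\sigma_k^{-2}\big(d+\log(1/\delta)\big)\max_i\frac{w_i\eta_i^2}{m_i}\right).$$ -/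

import Mathlib

open MeasureTheory ProbabilityTheory

noncomputable section

namespace HeteroPCA

/-- The random variable `X` has sub-Gaussian constant `b`: it is integrable and
`E[|X - E X| ^ p] ^ (1 / p) ≤ b * √p` for every real `p ≥ 1`, all these moments being finite. -/
def IsSubGaussian {Ω : Type*} [MeasurableSpace Ω] (P : Measure Ω) (X : Ω → ℝ) (b : ℝ) : Prop :=
  Integrable X P ∧ ∀ p : ℝ, 1 ≤ p →
    Integrable (fun ω => |X ω - ∫ ω', X ω' ∂P| ^ p) P ∧
    (∫ ω, |X ω - ∫ ω', X ω' ∂P| ^ p ∂P) ^ (1 / p) ≤ b * √p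

/-- The random vector `Y` has sub-Gaussian constant `b`: so does `uᵀ Y` for every unit vector
`u`. -/
def IsSubGaussianVec {Ω : Type*} [MeasurableSpace Ω] (P : Measure Ω) {d : ℕ}
    (Y : Ω → EuclideanSpace ℝ (Fin d)) (b : ℝ) : Prop :=
  ∀ u : EuclideanSpace ℝ (Fin d), ‖u‖ = 1 → IsSubGaussian P (fun ω => inner ℝ u (Y ω)) b

/-- The outer product `x yᵀ`. -/
def outer {d : ℕ} (x y : EuclideanSpace ℝ (Fin d)) : Matrix (Fin d) (Fin d) ℝ :=
  Matrix.vecMulVec x.ofLp y.ofLp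

/-- The spectral norm, i.e. the operator norm with respect to the Euclidean norm. -/
def specNorm {d : ℕ} (M : Matrix (Fin d) (Fin d) ℝ) : ℝ :=
  ‖Matrix.toEuclideanCLM (n := Fin d) (𝕜 := ℝ) M‖

open Classical in
/-- The `k`-th largest eigenvalue, counted with multiplicity (`k = 1, …, d`), of a real symmetric
`d × d` matrix; it is `0` by convention if the matrix is not symmetric or `k` is out of range.
Mathlib's `eigenvalues` lists the eigenvalues with multiplicity in decreasing order. -/
def kthEigenvalue {d : ℕ} (M : Matrix (Fin d) (Fin d) ℝ) (k : ℕ) : ℝ :=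
  if h : M.IsHermitian ∧ 1 ≤ k ∧ k ≤ d then
    (Matrix.isSymmetric_toEuclideanLin_iff.2 h.1).eigenvalues finrank_euclideanSpace_fin
      ⟨k - 1, by omega⟩
  else 0

/-- `G` is spanned by top-`k` eigenvectors of `M`: for some orthonormal basis of eigenvectors of
`M`, ordered by decreasing eigenvalue, `G` is the span of the first `k` of them. (In case of ties
between eigenvalues several subspaces `G` may qualify.) -/
def IsTopEigenspace {d : ℕ} (M : Matrix (Fin d) (Fin d) ℝ) (k : ℕ)
    (G : Submodule ℝ (EuclideanSpace ℝ (Fin d))) : Prop :=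
  ∃ (b : OrthonormalBasis (Fin d) ℝ (EuclideanSpace ℝ (Fin d))) (l : Fin d → ℝ),
    Antitone l ∧ (∀ i, Matrix.toEuclideanLin M (b i) = l i • b i) ∧
    G = Submodule.span ℝ (b '' {i | (i : ℕ) < k})

/-- The maximum principal angle `θ ∈ [0, π / 2]` between two subspaces of equal dimension:
`sin θ` is the operator norm of the difference of the orthogonal projections. -/
def maxPrincipalAngle {d : ℕ} (G H : Submodule ℝ (EuclideanSpace ℝ (Fin d))) : ℝ :=
  Real.arcsin ‖G.starProjection - H.starProjection‖

/-- The matrix `A = ∑ i, w i / (m i (m i - 1)) ∑_{j₁ ≠ j₂} x_{i j₁} x_{i j₂}ᵀ`. -/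
def estMatrix {n d : ℕ} (m : Fin n → ℕ) (w : Fin n → ℝ)
    (x : (i : Fin n) → Fin (m i) → EuclideanSpace ℝ (Fin d)) : Matrix (Fin d) (Fin d) ℝ :=
  ∑ i, (w i / ((m i : ℝ) * ((m i : ℝ) - 1))) •
    ∑ j ∈ (Finset.univ : Finset (Fin (m i))).offDiag, outer (x i j.1) (x i j.2)

/-- `σ_k²`: the `k`-th largest eigenvalue of `∑ i, w i μ_i μ_iᵀ`. -/
def sigmaSq {n d : ℕ} (w : Fin n → ℝ) (μ : Fin n → EuclideanSpace ℝ (Fin d)) (k : ℕ) : ℝ :=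
  kthEigenvalue (∑ i, w i • outer (μ i) (μ i)) k

/-- `ξ² = ‖∑ i, (w i² η i² / m i) μ_i μ_iᵀ‖`. -/
def xiSq {n d : ℕ} (m : Fin n → ℕ) (w η : Fin n → ℝ)
    (μ : Fin n → EuclideanSpace ℝ (Fin d)) : ℝ :=
  specNorm (∑ i, (w i ^ 2 * η i ^ 2 / (m i : ℝ)) • outer (μ i) (μ i))

end HeteroPCA

end

/-!
In a fixed unit direction `u`, the deviation of `⟪u, A u⟫` from its mean splits into independent
blocks: a linear term in the noise `ζ j = ⟪u, z i j⟫` plus the off-diagonal quadratic form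
`∑_{j₁ ≠ j₂} ζ j₁ ζ j₂ = (∑ ζ)² - ∑ ζ²`, in which the two squares have the same mean. Since `∑ ζ`
and each `ζ j` are sub-Gaussian, the centred squares are sub-exponential, and Bernstein's inequality
applies to the sum over the blocks. A union bound over a `1/2`-net of the sphere turns this into a
bound on the operator norm of the difference between `A` and its mean `∑ w i μ i μ iᵀ`. As this mean
vanishes on `Γᗮ` and is at least `σ_k²` on `Γ`, a Davis–Kahan estimate bounds `sin θ` by twice the
relative perturbation.
-/

namespace HeteroPCA

open scoped NNReal ENNReal Nat RealInnerProductSpace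

/-! ### Moments and moment generating functions -/

section MGF

variable {Ω : Type*} [MeasurableSpace Ω] {P : Measure Ω} {X Y : Ω → ℝ}

/-- Sub-Gaussianity in terms of even moments: `E[X ^ (2k)] ≤ k! a ^ k`. The number `a` plays the
role of a variance proxy, and the condition passes easily to `exp (t X²)`. -/
def HasSubgaussianMoments (P : Measure Ω) (X : Ω → ℝ) (a : ℝ≥0) : Prop :=
  ∀ k : ℕ, Integrable (fun ω => X ω ^ (2 * k)) P ∧ ∫ ω, X ω ^ (2 * k) ∂P ≤ k ! * (a : ℝ) ^ k

/-- `X` is sub-exponential with variance proxy `V` and scale `R`: its moment generating function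
has the Gaussian bound `exp (t² V)` on the interval `|t| R ≤ 1`. -/
def HasSubexponentialMGF (P : Measure Ω) (X : Ω → ℝ) (V R : ℝ) : Prop :=
  ∀ t : ℝ, |t| * R ≤ 1 → Integrable (fun ω => Real.exp (t * X ω)) P ∧
    mgf X P t ≤ Real.exp (t ^ 2 * V)

theorem exp_le_self_add_exp_sq (x : ℝ) : Real.exp x ≤ x + Real.exp (x ^ 2) := by
  have hsq := Real.add_one_le_exp (x ^ 2)
  rcases le_or_gt |x| 1 with hx | hx
  · linarith [(abs_le.1 (Real.abs_exp_sub_one_sub_id_le hx)).2]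
  · rcases lt_abs.1 hx with hx | hx
    · linarith [Real.exp_le_exp.2 (show x ≤ x ^ 2 by nlinarith)]
    · nlinarith [Real.exp_le_one_iff.2 (show x ≤ 0 by linarith)]

theorem exp_le_one_add_self_add_sq_mul_exp_abs (x : ℝ) :
    Real.exp x ≤ 1 + x + x ^ 2 * Real.exp |x| := by
  rcases le_or_gt |x| 1 with hx | hx
  · nlinarith [(abs_le.1 (Real.abs_exp_sub_one_sub_id_le hx)).2, sq_nonneg x,
      Real.one_le_exp (abs_nonneg x)]
  · rcases lt_abs.1 hx with hx | hx
    · rw [abs_of_pos (by linarith)]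
      linarith [mul_nonneg (show 0 ≤ x ^ 2 - 1 by nlinarith) (Real.exp_pos x).le]
    · nlinarith [Real.exp_le_one_iff.2 (show x ≤ 0 by linarith), sq_nonneg x,
        Real.one_le_exp (abs_nonneg x)]

theorem pow_self_le_factorial_mul_three_pow (k : ℕ) : (k : ℝ) ^ k ≤ k ! * 3 ^ k := by
  have h := Real.pow_div_factorial_le_exp (x := k) (by positivity) k
  rw [div_le_iff₀ (by positivity), ← mul_one (k : ℝ), Real.exp_nat_mul, mul_one, mul_comm] at h
  exact h.trans (by gcongr; exact Real.exp_one_lt_three.le)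

theorem integrable_and_integral_le_of_le {f g : Ω → ℝ} (hf : AEStronglyMeasurable f P)
    (hf0 : ∀ ω, 0 ≤ f ω) (hg : Integrable g P) (hfg : ∀ ω, f ω ≤ g ω) :
    Integrable f P ∧ ∫ ω, f ω ∂P ≤ ∫ ω, g ω ∂P := by
  have hfi : Integrable f P := hg.mono' hf (.of_forall fun ω => by
    rw [Real.norm_of_nonneg (hf0 ω)]; exact hfg ω)
  exact ⟨hfi, integral_mono hfi hg hfg⟩

theorem integrable_and_integral_le_of_lintegral_le {f : Ω → ℝ} (hf : AEStronglyMeasurable f P)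
    (hf0 : ∀ ω, 0 ≤ f ω) {c : ℝ} (hc : 0 ≤ c)
    (hle : ∫⁻ ω, ENNReal.ofReal (f ω) ∂P ≤ ENNReal.ofReal c) :
    Integrable f P ∧ ∫ ω, f ω ∂P ≤ c := by
  refine ⟨⟨hf, ?_⟩, ?_⟩
  · rw [hasFiniteIntegral_iff_ofReal (.of_forall hf0)]
    exact hle.trans_lt ENNReal.ofReal_lt_top
  · rw [integral_eq_lintegral_of_nonneg_ae (.of_forall hf0) hf]
    exact ENNReal.toReal_le_of_le_ofReal hc hle

theorem IsSubGaussian.hasSubgaussianMoments [IsProbabilityMeasure P] {η : ℝ}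
    (h : IsSubGaussian P X η) (h0 : ∫ ω, X ω ∂P = 0) :
    HasSubgaussianMoments P X (6 * ‖η‖₊ ^ 2) := by
  intro k
  rcases Nat.eq_zero_or_pos k with rfl | hk
  · simp
  have hk1 : (1 : ℝ) ≤ k := by exact_mod_cast hk
  obtain ⟨hint, hle⟩ := h.2 ((2 * k : ℕ) : ℝ) (by push_cast; linarith)
  simp only [h0, sub_zero, Real.rpow_natCast, (even_two_mul k).pow_abs] at hint hle
  have hnonneg : 0 ≤ ∫ ω, X ω ^ (2 * k) ∂P :=
    integral_nonneg fun ω => (even_two_mul k).pow_nonneg _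
  have hpow := pow_le_pow_left₀ (Real.rpow_nonneg hnonneg _) hle (2 * k)
  rw [one_div, Real.rpow_inv_natCast_pow hnonneg (by omega)] at hpow
  refine ⟨hint, ?_⟩
  calc ∫ ω, X ω ^ (2 * k) ∂P ≤ (η * √((2 * k : ℕ) : ℝ)) ^ (2 * k) := hpow
    _ = (2 * η ^ 2) ^ k * k ^ k := by
        rw [pow_mul, mul_pow, Real.sq_sqrt (by positivity), ← mul_pow]; push_cast; ring
    _ ≤ (2 * η ^ 2) ^ k * (k ! * 3 ^ k) := by
        gcongr; exact pow_self_le_factorial_mul_three_pow k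
    _ = k ! * ((6 * ‖η‖₊ ^ 2 : ℝ≥0) : ℝ) ^ k := by
        push_cast
        rw [Real.norm_eq_abs, sq_abs, show 6 * η ^ 2 = 2 * η ^ 2 * 3 by ring, mul_pow (2 * η ^ 2)]
        ring

namespace HasSubgaussianMoments

variable {a : ℝ≥0}

theorem of_ae_eq_zero [IsProbabilityMeasure P] (h : X =ᵐ[P] 0) : HasSubgaussianMoments P X a := by
  intro k
  have hpow : (fun ω => X ω ^ (2 * k)) =ᵐ[P] fun _ => 0 ^ (2 * k) := by
    filter_upwards [h] with ω hω
    rw [hω, Pi.zero_apply]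
  refine ⟨(integrable_congr hpow).2 (integrable_const _), ?_⟩
  rw [integral_congr_ae hpow]
  rcases Nat.eq_zero_or_pos k with rfl | hk
  · simp
  · simp only [zero_pow (Nat.mul_ne_zero two_ne_zero hk.ne'), integral_zero]
    positivity

theorem integrable_sq (h : HasSubgaussianMoments P X a) : Integrable (fun ω => X ω ^ 2) P := by
  simpa using (h 1).1

theorem memLp_two (h : HasSubgaussianMoments P X a) (hX : AEMeasurable X P) : MemLp X 2 P :=
  (memLp_two_iff_integrable_sq hX.aestronglyMeasurable).2 h.integrable_sq

theorem ae_eq_zero (h : HasSubgaussianMoments P X 0) : X =ᵐ[P] 0 := by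
  have hle : ∫ ω, X ω ^ 2 ∂P ≤ 0 := by simpa using (h 1).2
  have hsq := (integral_eq_zero_iff_of_nonneg (fun ω => sq_nonneg (X ω)) h.integrable_sq).1
    (hle.antisymm (integral_nonneg fun ω => sq_nonneg (X ω)))
  filter_upwards [hsq] with ω hω
  simpa using hω

theorem lintegral_pow_div_factorial_le (h : HasSubgaussianMoments P X a) {t : ℝ} (ht : 0 ≤ t)
    (k : ℕ) :
    ∫⁻ ω, ENNReal.ofReal ((t * X ω ^ 2) ^ k / k !) ∂P ≤ ENNReal.ofReal ((t * a) ^ k) := by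
  have hterm : ∀ ω, (t * X ω ^ 2) ^ k / k ! = t ^ k / k ! * X ω ^ (2 * k) := fun ω => by
    rw [mul_pow, ← pow_mul]; ring
  simp only [hterm]
  rw [← ofReal_integral_eq_lintegral_ofReal ((h k).1.const_mul _)
    (.of_forall fun ω => mul_nonneg (by positivity) ((even_two_mul k).pow_nonneg _)),
    integral_const_mul]
  refine ENNReal.ofReal_le_ofReal ?_
  calc t ^ k / k ! * ∫ ω, X ω ^ (2 * k) ∂P ≤ t ^ k / k ! * (k ! * (a : ℝ) ^ k) := by
        gcongr; exact (h k).2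
    _ = (t * a) ^ k := by rw [mul_pow]; field_simp

theorem integral_exp_mul_sq_le (h : HasSubgaussianMoments P X a) (hX : AEMeasurable X P) {t : ℝ}
    (ht : 0 ≤ t) (hta : t * a ≤ 1 / 2) :
    Integrable (fun ω => Real.exp (t * X ω ^ 2)) P ∧
      ∫ ω, Real.exp (t * X ω ^ 2) ∂P ≤ 1 + 2 * (t * a) := by
  have hta0 : 0 ≤ t * a := by positivity
  refine integrable_and_integral_le_of_lintegral_le
    (Real.measurable_exp.comp_aemeasurable ((hX.pow_const 2).const_mul t)).aestronglyMeasurable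
    (fun _ => (Real.exp_pos _).le) (by positivity) ?_
  have hexp : ∀ ω, ENNReal.ofReal (Real.exp (t * X ω ^ 2)) =
      ∑' k : ℕ, ENNReal.ofReal ((t * X ω ^ 2) ^ k / k !) := fun ω => by
    rw [Real.exp_eq_exp_ℝ, NormedSpace.exp_eq_tsum_div,
      ENNReal.ofReal_tsum_of_nonneg (fun k => by positivity) (Real.summable_pow_div_factorial _)]
  calc ∫⁻ ω, ENNReal.ofReal (Real.exp (t * X ω ^ 2)) ∂P
      = ∑' k : ℕ, ∫⁻ ω, ENNReal.ofReal ((t * X ω ^ 2) ^ k / k !) ∂P := by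
        simp only [hexp]; exact lintegral_tsum fun k => by fun_prop
    _ ≤ ∑' k : ℕ, ENNReal.ofReal ((t * a) ^ k) :=
        ENNReal.tsum_le_tsum (h.lintegral_pow_div_factorial_le ht)
    _ = ENNReal.ofReal (1 - t * a)⁻¹ := by
        rw [← ENNReal.ofReal_tsum_of_nonneg (fun k => by positivity)
          (summable_geometric_of_lt_one hta0 (by linarith)),
          tsum_geometric_of_lt_one hta0 (by linarith)]
    _ ≤ ENNReal.ofReal (1 + 2 * (t * a)) := by
        refine ENNReal.ofReal_le_ofReal ?_
        rw [inv_le_iff_one_le_mul₀ (by linarith)]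
        nlinarith

theorem mgf_le_of_sq_mul_le [IsProbabilityMeasure P] (h : HasSubgaussianMoments P X a)
    (hX : AEMeasurable X P) (h0 : ∫ ω, X ω ∂P = 0) {t : ℝ} (ht : t ^ 2 * a ≤ 1 / 2) :
    Integrable (fun ω => Real.exp (t * X ω)) P ∧ mgf X P t ≤ Real.exp (2 * (t ^ 2 * a)) := by
  have hXi : Integrable X P := (h.memLp_two hX).integrable (by norm_num)
  obtain ⟨hint, hle⟩ := h.integral_exp_mul_sq_le hX (sq_nonneg t) ht
  obtain ⟨hexp, hmgf⟩ := integrable_and_integral_le_of_le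
    (f := fun ω => Real.exp (t * X ω)) (g := fun ω => t * X ω + Real.exp (t ^ 2 * X ω ^ 2))
    (Real.measurable_exp.comp_aemeasurable (hX.const_mul t)).aestronglyMeasurable
    (fun ω => (Real.exp_pos _).le) ((hXi.const_mul t).add hint)
    fun ω => by rw [← mul_pow]; exact exp_le_self_add_exp_sq _
  refine ⟨hexp, ?_⟩
  calc mgf X P t ≤ ∫ ω, (t * X ω + Real.exp (t ^ 2 * X ω ^ 2)) ∂P := hmgf
    _ = ∫ ω, Real.exp (t ^ 2 * X ω ^ 2) ∂P := by
        rw [integral_add (hXi.const_mul t) hint, integral_const_mul, h0, mul_zero, zero_add]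
    _ ≤ 2 * (t ^ 2 * a) + 1 := by linarith
    _ ≤ Real.exp (2 * (t ^ 2 * a)) := Real.add_one_le_exp _

theorem mgf_le_of_le_sq_mul (h : HasSubgaussianMoments P X a)
    (hX : AEMeasurable X P) {t : ℝ} (ht : 1 / 2 < t ^ 2 * a) :
    Integrable (fun ω => Real.exp (t * X ω)) P ∧
      mgf X P t ≤ Real.exp (5 * (t ^ 2 * a) / 2) := by
  have ha : 0 < (a : ℝ) := pos_of_mul_pos_right (by linarith) (sq_nonneg t)
  have hτa : (2 * a : ℝ)⁻¹ * a = 1 / 2 := by field_simp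
  obtain ⟨hint, hle⟩ := h.integral_exp_mul_sq_le hX (t := (2 * a : ℝ)⁻¹) (by positivity) hτa.le
  -- AM-GM: `t x ≤ t² a / 2 + x² / (2a)`
  have hdom : ∀ ω, Real.exp (t * X ω) ≤
      Real.exp (t ^ 2 * a / 2) * Real.exp ((2 * a : ℝ)⁻¹ * X ω ^ 2) := fun ω => by
    have hsq : t ^ 2 * a / 2 + (2 * a : ℝ)⁻¹ * X ω ^ 2 - t * X ω =
      (2 * a : ℝ)⁻¹ * (t * a - X ω) ^ 2 := by field_simp; ring
    have : 0 ≤ (2 * a : ℝ)⁻¹ * (t * a - X ω) ^ 2 := by positivity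
    rw [← Real.exp_add]
    exact Real.exp_le_exp.2 (by linarith)
  obtain ⟨hexp, hmgf⟩ := integrable_and_integral_le_of_le
    (Real.measurable_exp.comp_aemeasurable (hX.const_mul t)).aestronglyMeasurable
    (fun ω => (Real.exp_pos _).le) (hint.const_mul _) hdom
  refine ⟨hexp, ?_⟩
  calc mgf X P t
      ≤ Real.exp (t ^ 2 * a / 2) * ∫ ω, Real.exp ((2 * a : ℝ)⁻¹ * X ω ^ 2) ∂P :=
        hmgf.trans_eq (integral_const_mul _ _)
    _ ≤ Real.exp (t ^ 2 * a / 2) * Real.exp 1 := by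
        gcongr; linarith [Real.add_one_le_exp (1 : ℝ)]
    _ ≤ Real.exp (5 * (t ^ 2 * a) / 2) := by
        rw [← Real.exp_add]; exact Real.exp_le_exp.2 (by linarith)

theorem hasSubgaussianMGF [IsProbabilityMeasure P] (h : HasSubgaussianMoments P X a)
    (hX : AEMeasurable X P) (h0 : ∫ ω, X ω ∂P = 0) : HasSubgaussianMGF X (5 * a) P := by
  have hmgf : ∀ t : ℝ, Integrable (fun ω => Real.exp (t * X ω)) P ∧
      mgf X P t ≤ Real.exp ((5 * a : ℝ≥0) * t ^ 2 / 2) := fun t => by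
    push_cast
    rcases le_or_gt (t ^ 2 * a : ℝ) (1 / 2) with ht | ht
    · obtain ⟨hint, hle⟩ := h.mgf_le_of_sq_mul_le hX h0 ht
      refine ⟨hint, hle.trans (Real.exp_le_exp.2 ?_)⟩
      nlinarith [show 0 ≤ t ^ 2 * (a : ℝ) by positivity]
    · obtain ⟨hint, hle⟩ := h.mgf_le_of_le_sq_mul hX ht
      exact ⟨hint, hle.trans_eq (by congr 1; ring)⟩
  exact ⟨fun t => (hmgf t).1, fun t => (hmgf t).2⟩

end HasSubgaussianMoments

theorem pow_two_mul_le_factorial_mul_exp_add_exp {t : ℝ} (ht : 0 < t) (x : ℝ) (k : ℕ) :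
    x ^ (2 * k) ≤ (2 * k)! / t ^ (2 * k) * (Real.exp (t * x) + Real.exp (-t * x)) := by
  have hpow := Real.pow_div_factorial_le_exp _ (abs_nonneg (t * x)) (2 * k)
  rw [(even_two_mul k).pow_abs, mul_pow, div_le_iff₀ (by positivity)] at hpow
  have habs : Real.exp |t * x| ≤ Real.exp (t * x) + Real.exp (-t * x) := by
    rw [neg_mul]
    rcases abs_choice (t * x) with h | h <;> rw [h] <;>
      linarith [Real.exp_pos (t * x), Real.exp_pos (-(t * x))]
  rw [div_mul_eq_mul_div, le_div_iff₀ (by positivity), mul_comm, mul_comm ((2 * k)! : ℝ)]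
  exact hpow.trans (by gcongr)

theorem integral_pow_two_mul_le_of_hasSubgaussianMGF {c : ℝ≥0} (h : HasSubgaussianMGF X c P)
    {t : ℝ} (ht : 0 < t) (k : ℕ) :
    Integrable (fun ω => X ω ^ (2 * k)) P ∧
      ∫ ω, X ω ^ (2 * k) ∂P ≤ (2 * k)! / t ^ (2 * k) * (2 * Real.exp (c * t ^ 2 / 2)) := by
  obtain ⟨hint, hle⟩ := integrable_and_integral_le_of_le
    (h.aemeasurable.pow_const (2 * k)).aestronglyMeasurable
    (fun ω => (even_two_mul k).pow_nonneg _)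
    (((h.integrable_exp_mul t).add (h.integrable_exp_mul (-t))).const_mul _)
    fun ω => pow_two_mul_le_factorial_mul_exp_add_exp ht (X ω) k
  refine ⟨hint, hle.trans ?_⟩
  have hneg : mgf X P (-t) ≤ Real.exp (c * t ^ 2 / 2) := by simpa only [neg_sq] using h.mgf_le (-t)
  have hadd : ∫ ω, (Real.exp (t * X ω) + Real.exp (-t * X ω)) ∂P = mgf X P t + mgf X P (-t) :=
    integral_add (h.integrable_exp_mul t) (h.integrable_exp_mul (-t))
  rw [integral_const_mul, Pi.add_def, hadd]
  gcongr
  linarith [h.mgf_le t]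

theorem hasSubgaussianMoments_of_hasSubgaussianMGF [IsProbabilityMeasure P] {c : ℝ≥0}
    (h : HasSubgaussianMGF X c P) : HasSubgaussianMoments P X (6 * c) := by
  rcases eq_or_ne c 0 with rfl | hc
  · exact .of_ae_eq_zero h.ae_eq_zero_of_hasSubgaussianMGF_zero
  intro k
  rcases Nat.eq_zero_or_pos k with rfl | hk
  · simp
  have : 0 < (c : ℝ) := by positivity
  have : 0 < (k : ℝ) := by exact_mod_cast hk
  -- the choice `t² = 2k / c` minimises `exp (c t² / 2) / t ^ (2k)`
  have ht2 : √(2 * k / c) ^ 2 = 2 * k / c := Real.sq_sqrt (by positivity)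
  obtain ⟨hint, hle⟩ := integral_pow_two_mul_le_of_hasSubgaussianMGF h
    (Real.sqrt_pos.2 (show 0 < 2 * k / (c : ℝ) by positivity)) k
  have hexp : Real.exp (c * (2 * k / c) / 2) = Real.exp 1 ^ k := by
    rw [← Real.exp_nat_mul]; congr 1; field_simp
  rw [pow_mul _ 2 k, ht2, hexp] at hle
  have hfac : ((2 * k)! : ℝ) ≤ (2 * k) ^ k * k ! := by exact_mod_cast Nat.factorial_two_mul_le k
  have htwo : (2 : ℝ) ≤ 2 ^ k := le_self_pow₀ one_le_two hk.ne'
  refine ⟨hint, ?_⟩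
  calc ∫ ω, X ω ^ (2 * k) ∂P
      ≤ ((2 * k)! : ℝ) / (2 * k / c) ^ k * (2 * Real.exp 1 ^ k) := hle
    _ ≤ ((2 * k) ^ k * k !) / (2 * k / c) ^ k * (2 ^ k * 3 ^ k) := by
        gcongr; exact Real.exp_one_lt_three.le
    _ = k ! * ((6 * c : ℝ≥0) : ℝ) ^ k := by
        push_cast
        rw [← mul_pow, div_pow, mul_pow 6 (c : ℝ)]; field_simp
        norm_num

namespace HasSubexponentialMGF

variable {V V' R R' : ℝ}

theorem of_ae_eq_zero [IsProbabilityMeasure P] (h : X =ᵐ[P] 0) (hV : 0 ≤ V) :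
    HasSubexponentialMGF P X V R := fun t _ => by
  have hexp : (fun ω => Real.exp (t * X ω)) =ᵐ[P] fun _ => 1 := by
    filter_upwards [h] with ω hω
    rw [hω, Pi.zero_apply, mul_zero, Real.exp_zero]
  refine ⟨(integrable_congr hexp).2 (integrable_const _), ?_⟩
  rw [mgf, integral_congr_ae hexp, integral_const, probReal_univ, one_smul]
  exact Real.one_le_exp (by positivity)

theorem of_hasSubgaussianMGF {c : ℝ≥0} (h : HasSubgaussianMGF X c P) (R : ℝ) :
    HasSubexponentialMGF P X (c / 2) R := fun t _ =>
  ⟨h.integrable_exp_mul t, (h.mgf_le t).trans_eq (by congr 1; ring)⟩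

theorem mono (h : HasSubexponentialMGF P X V R) (hV : V ≤ V') (hR : R ≤ R') :
    HasSubexponentialMGF P X V' R' := fun t ht => by
  obtain ⟨hint, hle⟩ := h t ((mul_le_mul_of_nonneg_left hR (abs_nonneg t)).trans ht)
  exact ⟨hint, hle.trans (Real.exp_le_exp.2 (by gcongr))⟩

theorem const_mul (h : HasSubexponentialMGF P X V R) (c : ℝ) :
    HasSubexponentialMGF P (fun ω => c * X ω) (c ^ 2 * V) (|c| * R) := fun t ht => by
  obtain ⟨hint, hle⟩ := h (t * c) (by rwa [abs_mul, mul_assoc])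
  simp only [mgf, ← mul_assoc] at *
  exact ⟨hint, hle.trans_eq (by congr 1; ring)⟩

theorem add (hX : HasSubexponentialMGF P X V R) (hY : HasSubexponentialMGF P Y V R) :
    HasSubexponentialMGF P (fun ω => X ω + Y ω) (4 * V) (2 * R) := fun t ht => by
  have ht2 : |2 * t| * R ≤ 1 := by rw [abs_mul, abs_two]; linarith
  obtain ⟨hXint, hXle⟩ := hX (2 * t) ht2
  obtain ⟨hYint, hYle⟩ := hY (2 * t) ht2
  have hsplit : ∀ ω, Real.exp (t * (X ω + Y ω)) =
      √(Real.exp (2 * t * X ω) * Real.exp (2 * t * Y ω)) := fun ω => by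
    rw [← Real.exp_add, ← Real.exp_half]; congr 1; ring
  have hdom : ∀ ω, Real.exp (t * (X ω + Y ω)) ≤
      2⁻¹ * (Real.exp (2 * t * X ω) + Real.exp (2 * t * Y ω)) := fun ω => by
    rw [hsplit, Real.sqrt_le_left (by positivity)]
    nlinarith [sq_nonneg (Real.exp (2 * t * X ω) - Real.exp (2 * t * Y ω))]
  have hmeas : AEStronglyMeasurable (fun ω => Real.exp (t * (X ω + Y ω))) P := by
    simp only [hsplit]
    exact Real.continuous_sqrt.comp_aestronglyMeasurable
      (hXint.aestronglyMeasurable.mul hYint.aestronglyMeasurable)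
  obtain ⟨hint, hle⟩ := integrable_and_integral_le_of_le hmeas (fun ω => (Real.exp_pos _).le)
    ((hXint.add hYint).const_mul 2⁻¹) hdom
  refine ⟨hint, ?_⟩
  calc mgf (fun ω => X ω + Y ω) P t ≤ 2⁻¹ * (mgf X P (2 * t) + mgf Y P (2 * t)) :=
        hle.trans_eq (by rw [integral_const_mul]; congr 1; exact integral_add hXint hYint)
    _ ≤ 2⁻¹ * (Real.exp ((2 * t) ^ 2 * V) + Real.exp ((2 * t) ^ 2 * V)) := by gcongr
    _ = Real.exp (t ^ 2 * (4 * V)) := by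
        rw [show (2 * t) ^ 2 * V = t ^ 2 * (4 * V) by ring]; ring

theorem sum {ι : Type*} [Fintype ι] {X : ι → Ω → ℝ} {V : ι → ℝ} (hind : iIndepFun X P)
    (hX : ∀ i, Measurable (X i)) (h : ∀ i, HasSubexponentialMGF P (X i) (V i) R) :
    HasSubexponentialMGF P (fun ω => ∑ i, X i ω) (∑ i, V i) R := fun t ht => by
  have := hind.isProbabilityMeasure
  rw [show (fun ω => ∑ i, X i ω) = ∑ i, X i by ext; simp]
  refine ⟨hind.integrable_exp_mul_sum hX fun i _ => (h i t ht).1, ?_⟩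
  rw [hind.mgf_sum hX, Finset.mul_sum, Real.exp_sum]
  exact Finset.prod_le_prod (fun i _ => mgf_nonneg) fun i _ => (h i t ht).2

theorem measureReal_lt_le_of_sq_mul_le [IsFiniteMeasure P] (h : HasSubexponentialMGF P X V R)
    {s t x : ℝ} (ht : 0 ≤ t) (htR : t * R ≤ 1) (htV : t ^ 2 * V ≤ s) (htx : 2 * s ≤ t * x) :
    P.real {ω | x < X ω} ≤ Real.exp (-s) := by
  obtain ⟨hint, hle⟩ := h t (by rwa [abs_of_nonneg ht])
  calc P.real {ω | x < X ω} ≤ P.real {ω | x ≤ X ω} :=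
        measureReal_mono fun ω (hω : x < X ω) => hω.le
    _ ≤ Real.exp (-t * x) * mgf X P t := measure_ge_le_exp_mul_mgf x ht hint
    _ ≤ Real.exp (-t * x) * Real.exp (t ^ 2 * V) := by gcongr
    _ ≤ Real.exp (-s) := by rw [← Real.exp_add]; exact Real.exp_le_exp.2 (by linarith)

theorem ae_eq_zero (h : HasSubexponentialMGF P X 0 0) : X =ᵐ[P] 0 :=
  HasSubgaussianMGF.ae_eq_zero_of_hasSubgaussianMGF_zero
    ⟨fun t => (h t (by simp)).1, fun t => by simpa using (h t (by simp)).2⟩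

theorem measureReal_lt_le [IsFiniteMeasure P] {s : ℝ} (h : HasSubexponentialMGF P X V R)
    (hV : 0 ≤ V) (hR : 0 ≤ R) (hs : 0 < s) :
    P.real {ω | 2 * √(s * V) + 2 * (s * R) < X ω} ≤ Real.exp (-s) := by
  rcases le_or_gt V (s * R ^ 2) with hVR | hVR
  · rcases hR.eq_or_lt with rfl | hR0
    · obtain rfl : V = 0 := hV.antisymm' (by simpa using hVR)
      rw [(measureReal_eq_zero_iff).2 (measure_mono_null ?_ (ae_iff.1 h.ae_eq_zero))]
      · positivity
      · intro ω hω
        simp only [mul_zero, Real.sqrt_zero, add_zero, Set.mem_ofPred_eq] at hω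
        exact hω.ne'
    · refine h.measureReal_lt_le_of_sq_mul_le (t := R⁻¹) (by positivity)
        (inv_mul_cancel₀ hR0.ne').le ?_ ?_
      · rwa [inv_pow, inv_mul_le_iff₀ (by positivity), mul_comm]
      · have hmul : R⁻¹ * (2 * √(s * V) + 2 * (s * R)) = 2 * (R⁻¹ * √(s * V)) + 2 * s := by
          field_simp
        rw [hmul]
        exact le_add_of_nonneg_left (by positivity)
  · have hV0 : 0 < V := lt_of_le_of_lt (by positivity) hVR
    have hsq : √(s / V) ^ 2 = s / V := Real.sq_sqrt (by positivity)
    refine h.measureReal_lt_le_of_sq_mul_le (t := √(s / V)) (Real.sqrt_nonneg _) ?_ ?_ ?_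
    · rw [← pow_le_one_iff_of_nonneg (by positivity) two_ne_zero, mul_pow, hsq,
        div_mul_eq_mul_div, div_le_one hV0]
      exact hVR.le
    · rw [hsq, div_mul_cancel₀ _ hV0.ne']
    · have hmul : √(s / V) * √(s * V) = s := by
        rw [← Real.sqrt_mul (by positivity), show s / V * (s * V) = s ^ 2 by field_simp,
          Real.sqrt_sq hs.le]
      nlinarith [show 0 ≤ √(s / V) * (s * R) by positivity]

theorem measureReal_lt_abs_le [IsFiniteMeasure P] {s : ℝ} (h : HasSubexponentialMGF P X V R)
    (hV : 0 ≤ V) (hR : 0 ≤ R) (hs : 0 < s) :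
    P.real {ω | 2 * √(s * V) + 2 * (s * R) < |X ω|} ≤ 2 * Real.exp (-s) := by
  have hneg : HasSubexponentialMGF P (fun ω => -X ω) V R := by simpa using h.const_mul (-1)
  simp only [lt_abs, Set.ofPred_or]
  calc _ ≤ _ := measureReal_union_le _ _
    _ ≤ Real.exp (-s) + Real.exp (-s) :=
      add_le_add (h.measureReal_lt_le hV hR hs) (hneg.measureReal_lt_le hV hR hs)
    _ = 2 * Real.exp (-s) := by ring

end HasSubexponentialMGF

theorem exp_mul_le_one_add_add_sq_mul_exp {t τ y : ℝ} (hτ : 0 < τ) (ht : |t| ≤ τ / 2)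
    (hy : 0 ≤ y) :
    Real.exp (t * y) ≤ 1 + t * y + t ^ 2 * (8 / τ ^ 2) * Real.exp (τ * y) := by
  have habs : Real.exp |t * y| ≤ Real.exp (τ / 2 * y) := Real.exp_le_exp.2 (by
    rw [abs_mul, abs_of_nonneg hy]; gcongr)
  have hquad : y ^ 2 ≤ 8 / τ ^ 2 * Real.exp (τ / 2 * y) := by
    have := Real.quadratic_le_exp_of_nonneg (x := τ / 2 * y) (by positivity)
    rw [div_mul_eq_mul_div, le_div_iff₀ (by positivity)]
    nlinarith [mul_nonneg hτ.le hy]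
  have hexp : Real.exp (τ * y) = Real.exp (τ / 2 * y) * Real.exp (τ / 2 * y) := by
    rw [← Real.exp_add]; congr 1; ring
  calc Real.exp (t * y) ≤ 1 + t * y + (t * y) ^ 2 * Real.exp |t * y| :=
        exp_le_one_add_self_add_sq_mul_exp_abs _
    _ ≤ 1 + t * y + t ^ 2 * (8 / τ ^ 2 * Real.exp (τ / 2 * y)) * Real.exp (τ / 2 * y) := by
        rw [mul_pow]; gcongr
    _ = 1 + t * y + t ^ 2 * (8 / τ ^ 2) * Real.exp (τ * y) := by rw [hexp]; ring

theorem HasSubgaussianMoments.integral_exp_mul_sq_le_exp [IsProbabilityMeasure P] {a : ℝ≥0}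
    (h : HasSubgaussianMoments P X a) (hX : AEMeasurable X P) (ha : 0 < a) {t : ℝ}
    (ht : |t| * (4 * a) ≤ 1) :
    Integrable (fun ω => Real.exp (t * X ω ^ 2)) P ∧ ∫ ω, Real.exp (t * X ω ^ 2) ∂P ≤
      Real.exp (t * ∫ ω, X ω ^ 2 ∂P + t ^ 2 * (64 * a ^ 2)) := by
  have : (0 : ℝ) < a := ha
  set τ : ℝ := (2 * a)⁻¹ with hτ
  have hτ0 : 0 < τ := by positivity
  have hτa : τ * a = 1 / 2 := by rw [hτ]; field_simp
  have htτ : |t| ≤ τ / 2 := by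
    rw [hτ, ← one_div, div_div, le_div_iff₀ (by positivity)]; linarith
  obtain ⟨hint, hle⟩ := h.integral_exp_mul_sq_le hX hτ0.le hτa.le
  have hlin : Integrable (fun ω => 1 + t * X ω ^ 2) P :=
    (integrable_const 1).add (h.integrable_sq.const_mul t)
  obtain ⟨hexp, hbound⟩ := integrable_and_integral_le_of_le
    (Real.measurable_exp.comp_aemeasurable ((hX.pow_const 2).const_mul t)).aestronglyMeasurable
    (fun ω => (Real.exp_pos _).le) (hlin.add (hint.const_mul (t ^ 2 * (8 / τ ^ 2))))
    fun ω => exp_mul_le_one_add_add_sq_mul_exp hτ0 htτ (sq_nonneg (X ω))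
  refine ⟨hexp, hbound.trans ?_⟩
  calc ∫ ω, (1 + t * X ω ^ 2 + t ^ 2 * (8 / τ ^ 2) * Real.exp (τ * X ω ^ 2)) ∂P
      = 1 + t * ∫ ω, X ω ^ 2 ∂P + t ^ 2 * (8 / τ ^ 2) * ∫ ω, Real.exp (τ * X ω ^ 2) ∂P := by
        rw [integral_add hlin (hint.const_mul _), integral_add (integrable_const 1)
          (h.integrable_sq.const_mul t), integral_const_mul, integral_const_mul,
          integral_const, probReal_univ, one_smul]
    _ ≤ 1 + t * ∫ ω, X ω ^ 2 ∂P + t ^ 2 * (8 / τ ^ 2) * 2 := by gcongr; linarith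
    _ = (t * ∫ ω, X ω ^ 2 ∂P + t ^ 2 * (64 * a ^ 2)) + 1 := by rw [hτ]; field_simp; ring
    _ ≤ Real.exp (t * ∫ ω, X ω ^ 2 ∂P + t ^ 2 * (64 * a ^ 2)) := Real.add_one_le_exp _

theorem HasSubgaussianMoments.hasSubexponentialMGF_sq_sub [IsProbabilityMeasure P] {a : ℝ≥0}
    (h : HasSubgaussianMoments P X a) (hX : AEMeasurable X P) :
    HasSubexponentialMGF P (fun ω => X ω ^ 2 - ∫ ω', X ω' ^ 2 ∂P) (64 * a ^ 2) (4 * a) := by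
  rcases eq_zero_or_pos a with rfl | ha
  · have hsq : (fun ω => X ω ^ 2) =ᵐ[P] 0 := by
      filter_upwards [h.ae_eq_zero] with ω hω
      simp [hω]
    refine .of_ae_eq_zero ?_ (by positivity)
    rw [integral_congr_ae hsq]
    simpa using hsq
  intro t ht
  obtain ⟨hint, hle⟩ := h.integral_exp_mul_sq_le_exp hX ha ht
  have hsplit : ∀ ω, Real.exp (t * (X ω ^ 2 - ∫ ω', X ω' ^ 2 ∂P)) =
      Real.exp (-(t * ∫ ω', X ω' ^ 2 ∂P)) * Real.exp (t * X ω ^ 2) := fun ω => by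
    rw [← Real.exp_add]; congr 1; ring
  simp only [mgf, hsplit]
  refine ⟨hint.const_mul _, ?_⟩
  calc ∫ ω, Real.exp (-(t * ∫ ω', X ω' ^ 2 ∂P)) * Real.exp (t * X ω ^ 2) ∂P
      ≤ Real.exp (-(t * ∫ ω, X ω ^ 2 ∂P)) *
        Real.exp (t * ∫ ω, X ω ^ 2 ∂P + t ^ 2 * (64 * a ^ 2)) := by
        rw [integral_const_mul]; gcongr
    _ = Real.exp (t ^ 2 * (64 * a ^ 2)) := by rw [← Real.exp_add]; congr 1; ring

end MGF

/-! ### Independent sums and off-diagonal quadratic forms -/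

section Independence

variable {Ω : Type*} [MeasurableSpace Ω] {P : Measure Ω} [IsProbabilityMeasure P]

theorem iIndepFun_curry {ι : Type*} {κ : ι → Type*} {𝓧 : (i : ι) → κ i → Type*}
    {m𝓧 : ∀ i j, MeasurableSpace (𝓧 i j)} {X : (i : ι) → (j : κ i) → Ω → 𝓧 i j}
    (hX : ∀ i j, Measurable (X i j))
    (hind : iIndepFun (fun (p : (i : ι) × κ i) ω => X p.1 p.2 ω) P) :
    iIndepFun (fun i ω => (X i · ω)) P := by
  have : ∀ i j, IsProbabilityMeasure (P.map (X i j)) := fun i j =>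
    Measure.isProbabilityMeasure_map (hX i j).aemeasurable
  have hcurry : MeasurableEquiv.piCurry 𝓧 ∘ (fun ω p => X p.1 p.2 ω) = fun ω i j => X i j ω := by
    ext; simp [Sigma.curry]
  have hrow : ∀ i, iIndepFun (X i) P := fun i => hind.precomp (g := Sigma.mk i) sigma_mk_injective
  rw [iIndepFun_iff_map_fun_eq_infinitePi_map (by fun_prop), ← hcurry,
    ← Measure.map_map (by fun_prop) (by fun_prop),
    (iIndepFun_iff_map_fun_eq_infinitePi_map (by fun_prop)).1 hind,
    Measure.infinitePi_map_piCurry fun i j => P.map (X i j)]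
  congr with i
  rw [(iIndepFun_iff_map_fun_eq_infinitePi_map (by fun_prop)).1 (hrow i)]

theorem sum_offDiag_mul {κ R : Type*} [Fintype κ] [CommRing R] (f : κ → R) :
    ∑ p ∈ (Finset.univ : Finset κ).offDiag, f p.1 * f p.2 = (∑ j, f j) ^ 2 - ∑ j, f j ^ 2 := by
  classical
  have hprod : (∑ j, f j) ^ 2 =
      ∑ p ∈ (Finset.univ : Finset κ) ×ˢ Finset.univ, f p.1 * f p.2 := by
    rw [sq, Finset.sum_mul_sum, Finset.sum_product]
  rw [hprod, ← Finset.diag_union_offDiag, Finset.sum_union (Finset.disjoint_diag_offDiag _),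
    Finset.sum_diag]
  simp only [sq, add_sub_cancel_left]

variable {κ : Type*} [Fintype κ] {X : κ → Ω → ℝ}

theorem integral_sum_sq_of_iIndepFun (hX : ∀ j, MemLp (X j) 2 P) (h0 : ∀ j, ∫ ω, X j ω ∂P = 0)
    (hind : iIndepFun X P) :
    ∫ ω, (∑ j, X j ω) ^ 2 ∂P = ∑ j, ∫ ω, X j ω ^ 2 ∂P := by
  have hmean : ∫ ω, (∑ j, X j) ω ∂P = 0 := by
    simp only [Finset.sum_apply]
    rw [integral_finsetSum _ fun j _ => (hX j).integrable (by norm_num)]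
    exact Finset.sum_eq_zero fun j _ => h0 j
  have hvar := IndepFun.variance_sum (s := Finset.univ) (fun j _ => hX j)
    fun i _ j _ hij => hind.indepFun hij
  rw [variance_of_integral_eq_zero
    (Finset.aemeasurable_sum _ fun j _ => (hX j).aestronglyMeasurable.aemeasurable) hmean] at hvar
  simp only [Finset.sum_apply] at hvar
  rw [hvar]
  exact Finset.sum_congr rfl fun j _ =>
    variance_of_integral_eq_zero (hX j).aestronglyMeasurable.aemeasurable (h0 j)

variable {a : ℝ≥0}

theorem hasSubgaussianMGF_sum (hX : ∀ j, Measurable (X j)) (hind : iIndepFun X P)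
    (h0 : ∀ j, ∫ ω, X j ω ∂P = 0) (h : ∀ j, HasSubgaussianMoments P (X j) a) :
    HasSubgaussianMGF (fun ω => ∑ j, X j ω) (5 * Fintype.card κ * a) P := by
  convert HasSubgaussianMGF.sum_of_iIndepFun (s := Finset.univ) hind
    fun j _ => (h j).hasSubgaussianMGF (hX j).aemeasurable (h0 j) using 1
  rw [Finset.sum_const, Finset.card_univ, nsmul_eq_mul]
  ring

theorem hasSubexponentialMGF_sum_sq_sub (hX : ∀ j, Measurable (X j)) (hind : iIndepFun X P)
    (h : ∀ j, HasSubgaussianMoments P (X j) a) :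
    HasSubexponentialMGF P (fun ω => ∑ j, (X j ω ^ 2 - ∫ ω', X j ω' ^ 2 ∂P))
      (64 * Fintype.card κ * a ^ 2) (4 * a) := by
  have hsum := HasSubexponentialMGF.sum
    (hind.comp (fun j x => x ^ 2 - ∫ ω', X j ω' ^ 2 ∂P) fun j => by fun_prop)
    (fun j => ((hX j).pow_const 2).sub_const _)
    fun j => (h j).hasSubexponentialMGF_sq_sub (hX j).aemeasurable
  refine hsum.mono (le_of_eq ?_) le_rfl
  rw [Finset.sum_const, Finset.card_univ, nsmul_eq_mul]
  ring

theorem hasSubexponentialMGF_sum_offDiag [Nonempty κ]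
    (hX : ∀ j, Measurable (X j)) (hind : iIndepFun X P) (h0 : ∀ j, ∫ ω, X j ω ∂P = 0)
    (h : ∀ j, HasSubgaussianMoments P (X j) a) :
    HasSubexponentialMGF P
      (fun ω => ∑ p ∈ (Finset.univ : Finset κ).offDiag, X p.1 ω * X p.2 ω)
      ((480 * Fintype.card κ * a) ^ 2) (240 * Fintype.card κ * a) := by
  have hcard : (1 : ℝ) ≤ Fintype.card κ := by exact_mod_cast Fintype.card_pos
  have hS : AEMeasurable (fun ω => ∑ j, X j ω) P := by fun_prop
  -- the off-diagonal sum has mean zero, so it equals `(S² - E S²) - ∑ (X² - E X²)`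
  have hsplit : ∀ ω, ∑ p ∈ (Finset.univ : Finset κ).offDiag, X p.1 ω * X p.2 ω =
      ((∑ j, X j ω) ^ 2 - ∫ ω', (∑ j, X j ω') ^ 2 ∂P) +
        -1 * ∑ j, (X j ω ^ 2 - ∫ ω', X j ω' ^ 2 ∂P) := fun ω => by
    rw [sum_offDiag_mul fun j => X j ω, Finset.sum_sub_distrib,
      integral_sum_sq_of_iIndepFun (fun j => (h j).memLp_two (hX j).aemeasurable) h0 hind]
    ring
  have hsq := (hasSubgaussianMoments_of_hasSubgaussianMGF
    (hasSubgaussianMGF_sum hX hind h0 h)).hasSubexponentialMGF_sq_sub hS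
  have hdiag := (hasSubexponentialMGF_sum_sq_sub hX hind h).const_mul (-1)
  simp only [hsplit]
  refine ((hsq.mono (V' := 57600 * (Fintype.card κ * a) ^ 2) (R' := 120 * (Fintype.card κ * a))
    ?_ ?_).add (hdiag.mono ?_ ?_)).mono ?_ ?_
  · push_cast; linarith
  · push_cast; linarith
  · nlinarith [mul_le_mul_of_nonneg_right (mul_self_le_mul_self zero_le_one hcard)
      (sq_nonneg (a : ℝ)), mul_le_mul_of_nonneg_right hcard
      (mul_nonneg (zero_le_one.trans hcard) (sq_nonneg (a : ℝ)))]
  · rw [abs_neg, abs_one, one_mul]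
    nlinarith [mul_le_mul_of_nonneg_right hcard a.coe_nonneg, a.coe_nonneg]
  · linarith
  · linarith

theorem hasSubexponentialMGF_linear_add_offDiag [Nonempty κ]
    (hX : ∀ j, Measurable (X j)) (hind : iIndepFun X P) (h0 : ∀ j, ∫ ω, X j ω ∂P = 0)
    (h : ∀ j, HasSubgaussianMoments P (X j) a) (b c : ℝ) :
    HasSubexponentialMGF P (fun ω => b * ∑ j, X j ω +
        c * ∑ p ∈ (Finset.univ : Finset κ).offDiag, X p.1 ω * X p.2 ω)
      (10 * Fintype.card κ * a * b ^ 2 + 4 * (480 * c * Fintype.card κ * a) ^ 2)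
      (480 * |c| * Fintype.card κ * a) := by
  have hlin := (HasSubexponentialMGF.of_hasSubgaussianMGF
    (hasSubgaussianMGF_sum hX hind h0 h) 0).const_mul b
  have hquad := (hasSubexponentialMGF_sum_offDiag hX hind h0 h).const_mul c
  push_cast at hlin
  have hb : 0 ≤ Fintype.card κ * a * b ^ 2 := by positivity
  refine ((hlin.mono (V' := 5 * Fintype.card κ * a / 2 * b ^ 2 + (480 * c * Fintype.card κ * a) ^ 2)
    (R' := 240 * |c| * Fintype.card κ * a) ?_ ?_).add (hquad.mono ?_ ?_)).mono ?_ ?_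
  · nlinarith [sq_nonneg (c * Fintype.card κ * a)]
  · rw [mul_zero]; positivity
  · nlinarith
  · exact le_of_eq (by ring)
  · exact le_of_eq (by ring)
  · exact le_of_eq (by ring)

theorem hasSubexponentialMGF_sum_blocks {ι : Type*} [Fintype ι] {κ : ι → Type*}
    [∀ i, Fintype (κ i)] [∀ i, Nonempty (κ i)]
    {X : (i : ι) → κ i → Ω → ℝ} {a : ι → ℝ≥0} (hX : ∀ i j, Measurable (X i j))
    (hind : iIndepFun (fun p : (i : ι) × κ i => X p.1 p.2) P) (h0 : ∀ i j, ∫ ω, X i j ω ∂P = 0)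
    (h : ∀ i j, HasSubgaussianMoments P (X i j) (a i)) (b c : ι → ℝ) {R : ℝ}
    (hR : ∀ i, 480 * |c i| * Fintype.card (κ i) * a i ≤ R) :
    HasSubexponentialMGF P
      (fun ω => ∑ i, (b i * ∑ j, X i j ω +
        c i * ∑ p ∈ (Finset.univ : Finset (κ i)).offDiag, X i p.1 ω * X i p.2 ω))
      (∑ i, (10 * Fintype.card (κ i) * a i * b i ^ 2 +
        4 * (480 * c i * Fintype.card (κ i) * a i) ^ 2)) R := by
  refine HasSubexponentialMGF.sum ((iIndepFun_curry hX hind).comp (fun i x => b i * ∑ j, x j +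
    c i * ∑ p ∈ (Finset.univ : Finset (κ i)).offDiag, x p.1 * x p.2) fun i => by fun_prop)
    (fun i => by fun_prop) fun i => ?_
  exact (hasSubexponentialMGF_linear_add_offDiag (hX i)
    (hind.precomp (g := Sigma.mk i) sigma_mk_injective) (h0 i) (h i) (b i) (c i)).mono le_rfl (hR i)

end Independence

/-! ### Perturbation of top eigenspaces -/

section Eigenbasis

variable {E : Type*} [NormedAddCommGroup E] [InnerProductSpace ℝ E] {ι : Type*} [Fintype ι]

theorem finrank_span_image_orthonormalBasis (b : OrthonormalBasis ι ℝ E) (s : Finset ι) :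
    Module.finrank ℝ (Submodule.span ℝ (b '' s)) = s.card := by
  have hli : LinearIndependent ℝ fun i : s => b i :=
    b.orthonormal.linearIndependent.comp _ Subtype.val_injective
  rw [Set.image_eq_range]
  exact (finrank_span_eq_card hli).trans (Fintype.card_coe s)

theorem inner_eq_zero_of_mem_span_image (b : OrthonormalBasis ι ℝ E) {s : Set ι} {v : E}
    (hv : v ∈ Submodule.span ℝ (b '' s)) {j : ι} (hj : j ∉ s) : ⟪b j, v⟫ = 0 := by
  have hle : Submodule.span ℝ (b '' s) ≤ (ℝ ∙ b j)ᗮ := by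
    rw [Submodule.span_le]
    rintro _ ⟨i, hi, rfl⟩
    exact Submodule.mem_orthogonal_singleton_iff_inner_right.2
      (b.orthonormal.2 fun h => hj (h ▸ hi))
  exact Submodule.mem_orthogonal_singleton_iff_inner_right.1 (hle hv)

theorem norm_sq_eq_sum_inner_sq (b : OrthonormalBasis ι ℝ E) (v : E) :
    ‖v‖ ^ 2 = ∑ i, ⟪b i, v⟫ ^ 2 := by
  simp [← b.sum_sq_norm_inner_right]

variable {A : E →L[ℝ] E} (b : OrthonormalBasis ι ℝ E) {l : ι → ℝ} (hb : ∀ i, A (b i) = l i • b i)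
include hb

theorem inner_apply_of_eigenbasis (i : ι) (v : E) : ⟪b i, A v⟫ = l i * ⟪b i, v⟫ := by
  classical
  conv_lhs => rw [← b.sum_repr' v]
  simp only [map_sum, map_smul, hb, inner_sum, real_inner_smul_right, b.inner_eq_ite, mul_ite,
    mul_one, mul_zero, Finset.sum_ite_eq, Finset.mem_univ, if_true]
  exact mul_comm _ _

theorem inner_self_apply_of_eigenbasis (v : E) : ⟪v, A v⟫ = ∑ i, l i * ⟪b i, v⟫ ^ 2 := by
  rw [← b.sum_inner_mul_inner]
  refine Finset.sum_congr rfl fun i _ => ?_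
  rw [inner_apply_of_eigenbasis b hb, real_inner_comm]
  ring

theorem le_inner_self_apply_of_mem_span {s : Set ι} {c : ℝ} (hs : ∀ i ∈ s, c ≤ l i) {v : E}
    (hv : v ∈ Submodule.span ℝ (b '' s)) : c * ‖v‖ ^ 2 ≤ ⟪v, A v⟫ := by
  rw [inner_self_apply_of_eigenbasis b hb, norm_sq_eq_sum_inner_sq b, Finset.mul_sum]
  refine Finset.sum_le_sum fun i _ => ?_
  by_cases hi : i ∈ s
  · exact mul_le_mul_of_nonneg_right (hs i hi) (sq_nonneg _)
  · simp [inner_eq_zero_of_mem_span_image b hv hi]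

theorem inner_self_apply_le_of_mem_span {s : Set ι} {c : ℝ} (hs : ∀ i ∈ s, l i ≤ c) {v : E}
    (hv : v ∈ Submodule.span ℝ (b '' s)) : ⟪v, A v⟫ ≤ c * ‖v‖ ^ 2 := by
  rw [inner_self_apply_of_eigenbasis b hb, norm_sq_eq_sum_inner_sq b, Finset.mul_sum]
  refine Finset.sum_le_sum fun i _ => ?_
  by_cases hi : i ∈ s
  · exact mul_le_mul_of_nonneg_right (hs i hi) (sq_nonneg _)
  · simp [inner_eq_zero_of_mem_span_image b hv hi]

theorem mul_norm_starProjection_le_norm_apply {s : Set ι}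
    [(Submodule.span ℝ (b '' s)).HasOrthogonalProjection] {c : ℝ} (hc : 0 ≤ c)
    (hs : ∀ i ∈ s, c ≤ l i) (v : E) :
    c * ‖(Submodule.span ℝ (b '' s)).starProjection v‖ ≤ ‖A v‖ := by
  set G := Submodule.span ℝ (b '' s)
  refine le_of_sq_le_sq ?_ (norm_nonneg _)
  rw [mul_pow, norm_sq_eq_sum_inner_sq b, norm_sq_eq_sum_inner_sq b, Finset.mul_sum]
  refine Finset.sum_le_sum fun i _ => ?_
  rw [inner_apply_of_eigenbasis b hb, mul_pow]
  by_cases hi : i ∈ s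
  · have hbi : G.starProjection (b i) = b i :=
      Submodule.starProjection_eq_self_iff.2 (Submodule.subset_span ⟨i, hi, rfl⟩)
    rw [← G.inner_starProjection_left_eq_right, hbi]
    exact mul_le_mul_of_nonneg_right (pow_le_pow_left₀ hc (hs i hi) 2) (sq_nonneg _)
  · rw [inner_eq_zero_of_mem_span_image b (G.starProjection_apply_mem v) hi, zero_pow two_ne_zero,
      mul_zero]
    positivity

variable [FiniteDimensional ℝ E]

theorem span_image_eq_of_range_le {Γ : Submodule ℝ E} {s : Finset ι} (hs : ∀ i ∈ s, l i ≠ 0)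
    (hA : ∀ v, A v ∈ Γ) (hΓ : Module.finrank ℝ Γ = s.card) : Submodule.span ℝ (b '' s) = Γ := by
  refine Submodule.eq_of_le_of_finrank_eq (Submodule.span_le.2 ?_)
    ((finrank_span_image_orthonormalBasis b s).trans hΓ.symm)
  rintro _ ⟨i, hi, rfl⟩
  exact (Γ.smul_mem_iff (hs i hi)).1 (hb i ▸ hA (b i))

end Eigenbasis

section OrderedEigenbasis

variable {E : Type*} [NormedAddCommGroup E] [InnerProductSpace ℝ E] [FiniteDimensional ℝ E]
  {d : ℕ} {A : E →L[ℝ] E} (b : OrthonormalBasis (Fin d) ℝ E) {l : Fin d → ℝ}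

theorem exists_ne_zero_mem_inf {U V : Submodule ℝ E}
    (h : Module.finrank ℝ E < Module.finrank ℝ U + Module.finrank ℝ V) :
    ∃ v ≠ 0, v ∈ U ∧ v ∈ V := by
  have hUV : U ⊓ V ≠ ⊥ := fun hbot =>
    h.not_ge (Submodule.finrank_add_finrank_le_of_disjoint (disjoint_iff.2 hbot))
  obtain ⟨v, hv, hv0⟩ := Submodule.exists_mem_ne_zero_of_ne_bot hUV
  exact ⟨v, hv0, hv⟩

theorem le_eigenvalue_of_forall_mem_le (hl : Antitone l) (hb : ∀ i, A (b i) = l i • b i)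
    {Γ : Submodule ℝ E} {c : ℝ} (hΓ : ∀ v ∈ Γ, c * ‖v‖ ^ 2 ≤ ⟪v, A v⟫) {i : Fin d}
    (hi : i < Module.finrank ℝ Γ) : c ≤ l i := by
  have hd : Module.finrank ℝ E = d := by simpa using Module.finrank_eq_card_basis b.toBasis
  obtain ⟨v, hv0, hvΓ, hvi⟩ := exists_ne_zero_mem_inf (U := Γ)
    (V := Submodule.span ℝ (b '' (Finset.Ici i))) (by
      rw [finrank_span_image_orthonormalBasis, Fin.card_Ici, hd]
      omega)
  have hle : ⟪v, A v⟫ ≤ l i * ‖v‖ ^ 2 :=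
    inner_self_apply_le_of_mem_span b hb (fun j hj => hl (Finset.mem_Ici.1 hj)) hvi
  exact le_of_mul_le_mul_right ((hΓ v hvΓ).trans hle) (by positivity)

theorem eigenvalue_mul_norm_sq_le (hl : Antitone l) (hb : ∀ i, A (b i) = l i • b i)
    {Γ : Submodule ℝ E} (hA : ∀ v, A v ∈ Γ) {i : Fin d} (hi : 0 < l i)
    (hΓ : Module.finrank ℝ Γ = i + 1) {v : E} (hv : v ∈ Γ) : l i * ‖v‖ ^ 2 ≤ ⟪v, A v⟫ := by
  have hle : ∀ j ∈ Finset.Iic i, l i ≤ l j := fun j hj => hl (Finset.mem_Iic.1 hj)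
  have hspan : Submodule.span ℝ (b '' Finset.Iic i) = Γ :=
    span_image_eq_of_range_le b hb (fun j hj => (hi.trans_le (hle j hj)).ne') hA
      (by rw [hΓ, Fin.card_Iic])
  exact le_inner_self_apply_of_mem_span b hb hle (hspan ▸ hv)

end OrderedEigenbasis

section ProjectionGap

variable {E : Type*} [NormedAddCommGroup E] [InnerProductSpace ℝ E] {G H : Submodule ℝ E} {s : ℝ}

section HasOrthogonalProjection

variable [G.HasOrthogonalProjection] [H.HasOrthogonalProjection]

theorem norm_sq_starProjection_sub_apply (y : E) :
    ‖(G.starProjection - H.starProjection) y‖ ^ 2 =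
      ‖G.starProjection (Hᗮ.starProjection y)‖ ^ 2 +
        ‖Gᗮ.starProjection (H.starProjection y)‖ ^ 2 := by
  set p := H.starProjection y
  set q := Hᗮ.starProjection y
  have hy : p + q = y := H.starProjection_add_starProjection_orthogonal y
  have hp : G.starProjection p + Gᗮ.starProjection p = p :=
    G.starProjection_add_starProjection_orthogonal p
  have hdiff : (G.starProjection - H.starProjection) y =
      G.starProjection q - Gᗮ.starProjection p :=
    calc (G.starProjection - H.starProjection) y
        = G.starProjection (p + q) - (G.starProjection p + Gᗮ.starProjection p) := by
          rw [hy, hp, sub_apply]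
      _ = G.starProjection q - Gᗮ.starProjection p := by rw [map_add]; abel
  have horth : ⟪G.starProjection q, Gᗮ.starProjection p⟫ = 0 :=
    Submodule.inner_right_of_mem_orthogonal (G.starProjection_apply_mem q)
      (Gᗮ.starProjection_apply_mem p)
  rw [hdiff, norm_sub_sq_real, horth]
  ring

theorem inner_starProjection_self (v : E) : ⟪G.starProjection v, v⟫ = ‖G.starProjection v‖ ^ 2 :=
  G.re_inner_starProjection_eq_normSq v

theorem norm_starProjection_orthogonal_le (hs : 0 ≤ s)
    (hGH : ∀ x ∈ Hᗮ, ‖G.starProjection x‖ ≤ s * ‖x‖) {g : E} (hg : g ∈ G) :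
    ‖Hᗮ.starProjection g‖ ≤ s * ‖g‖ := by
  set z := Hᗮ.starProjection g
  have hsq : ‖z‖ ^ 2 ≤ s * ‖g‖ * ‖z‖ :=
    calc ‖z‖ ^ 2 = ⟪z, g⟫ := (inner_starProjection_self g).symm
      _ = ⟪G.starProjection z, g⟫ := by
        rw [G.inner_starProjection_left_eq_right, Submodule.starProjection_eq_self_iff.2 hg]
      _ ≤ ‖G.starProjection z‖ * ‖g‖ := real_inner_le_norm _ _
      _ ≤ s * ‖z‖ * ‖g‖ := by gcongr; exact hGH z (Hᗮ.starProjection_apply_mem g)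
      _ = s * ‖g‖ * ‖z‖ := by ring
  rcases (norm_nonneg z).eq_or_lt with hz | hz
  · rw [← hz]
    positivity
  · exact le_of_mul_le_mul_right (by rwa [← sq]) hz

end HasOrthogonalProjection

variable [FiniteDimensional ℝ G] [FiniteDimensional ℝ H]

theorem exists_mem_starProjection_eq (hfin : Module.finrank ℝ G = Module.finrank ℝ H)
    (hinj : ∀ g ∈ G, H.starProjection g = 0 → g = 0) {h : E} (hh : h ∈ H) :
    ∃ g ∈ G, H.starProjection g = h := by
  let π : G →ₗ[ℝ] H := H.orthogonalProjectionOnto.toLinearMap ∘ₗ G.subtype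
  have hπ : Function.Injective π := by
    refine (injective_iff_map_eq_zero π).2 fun g hg => Subtype.ext (hinj g g.2 ?_)
    exact congrArg Subtype.val hg
  obtain ⟨g, hg⟩ := (LinearMap.injective_iff_surjective_of_finrank_eq_finrank hfin).1 hπ ⟨h, hh⟩
  exact ⟨g, g.2, congrArg Subtype.val hg⟩

theorem norm_starProjection_orthogonal_le_of_finrank_eq
    (hfin : Module.finrank ℝ G = Module.finrank ℝ H) (hs : 0 ≤ s) (hs1 : s < 1)
    (hGH : ∀ g ∈ G, ‖Hᗮ.starProjection g‖ ≤ s * ‖g‖) {h : E} (hh : h ∈ H) :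
    ‖Gᗮ.starProjection h‖ ≤ s * ‖h‖ := by
  have hcos : ∀ g ∈ G, (1 - s ^ 2) * ‖g‖ ^ 2 ≤ ‖H.starProjection g‖ ^ 2 := fun g hg => by
    have hsin : ‖Hᗮ.starProjection g‖ ^ 2 ≤ s ^ 2 * ‖g‖ ^ 2 := by
      rw [← mul_pow]
      exact pow_le_pow_left₀ (norm_nonneg _) (hGH g hg) 2
    linarith [H.norm_sq_eq_add_norm_sq_starProjection g]
  have ht : 0 < 1 - s ^ 2 := by nlinarith
  obtain ⟨g, hg, rfl⟩ := exists_mem_starProjection_eq hfin (fun g hg h0 => by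
    have hle : (1 - s ^ 2) * ‖g‖ ^ 2 ≤ 0 := by simpa [h0] using hcos g hg
    simpa using nonpos_of_mul_nonpos_right hle ht) hh
  set h := H.starProjection g
  set t := 1 - s ^ 2
  have hg0 : Gᗮ.starProjection (t • g) = 0 :=
    Submodule.starProjection_orthogonal_apply_eq_zero (G.smul_mem t hg)
  have hdist : ‖h - t • g‖ ^ 2 ≤ (s * ‖h‖) ^ 2 := by
    rw [norm_sub_sq_real, real_inner_smul_right, inner_starProjection_self, norm_smul,
      Real.norm_of_nonneg ht.le]
    linarith [mul_le_mul_of_nonneg_left (hcos g hg) ht.le]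
  calc ‖Gᗮ.starProjection h‖ = ‖Gᗮ.starProjection (h - t • g)‖ := by rw [map_sub, hg0, sub_zero]
    _ ≤ ‖h - t • g‖ := Gᗮ.norm_starProjection_apply_le _
    _ ≤ s * ‖h‖ := le_of_sq_le_sq hdist (by positivity)

theorem norm_starProjection_sub_le (hfin : Module.finrank ℝ G = Module.finrank ℝ H) (hs : 0 ≤ s)
    (hs1 : s < 1) (hGH : ∀ x ∈ Hᗮ, ‖G.starProjection x‖ ≤ s * ‖x‖) :
    ‖G.starProjection - H.starProjection‖ ≤ s := by
  refine ContinuousLinearMap.opNorm_le_bound _ hs fun y => le_of_sq_le_sq ?_ (by positivity)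
  have hG := hGH _ (Hᗮ.starProjection_apply_mem y)
  have hH := norm_starProjection_orthogonal_le_of_finrank_eq hfin hs hs1
    (fun g hg => norm_starProjection_orthogonal_le hs hGH hg) (H.starProjection_apply_mem y)
  calc ‖(G.starProjection - H.starProjection) y‖ ^ 2
      = ‖G.starProjection (Hᗮ.starProjection y)‖ ^ 2
        + ‖Gᗮ.starProjection (H.starProjection y)‖ ^ 2 := norm_sq_starProjection_sub_apply y
    _ ≤ (s * ‖Hᗮ.starProjection y‖) ^ 2 + (s * ‖H.starProjection y‖) ^ 2 := by gcongr
    _ = (s * ‖y‖) ^ 2 := by rw [mul_pow s ‖y‖, H.norm_sq_eq_add_norm_sq_starProjection y]; ring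

end ProjectionGap

section DavisKahan

variable {E : Type*} [NormedAddCommGroup E] [InnerProductSpace ℝ E] {A T : E →L[ℝ] E}

theorem inner_sub_norm_mul_norm_sq_le (v : E) :
    ⟪v, T v⟫ - ‖A - T‖ * ‖v‖ ^ 2 ≤ ⟪v, A v⟫ := by
  have habs : |⟪v, (A - T) v⟫| ≤ ‖A - T‖ * ‖v‖ ^ 2 :=
    calc |⟪v, (A - T) v⟫| ≤ ‖v‖ * ‖(A - T) v‖ := abs_real_inner_le_norm _ _
      _ ≤ ‖v‖ * (‖A - T‖ * ‖v‖) := by gcongr; exact (A - T).le_opNorm v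
      _ = ‖A - T‖ * ‖v‖ ^ 2 := by ring
  rw [sub_apply, inner_sub_right] at habs
  linarith [(abs_le.1 habs).1]

variable [FiniteDimensional ℝ E]

theorem norm_starProjection_span_sub_le {d k : ℕ} (b : OrthonormalBasis (Fin d) ℝ E)
    {l : Fin d → ℝ} (hl : Antitone l) (hb : ∀ i, A (b i) = l i • b i) {Γ : Submodule ℝ E}
    (hk : Module.finrank ℝ Γ = k) (hT : ∀ v ∈ Γᗮ, T v = 0) {σ : ℝ}
    (hσ : ∀ v ∈ Γ, σ * ‖v‖ ^ 2 ≤ ⟪v, T v⟫) (hlt : 2 * ‖A - T‖ < σ) :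
    ‖(Submodule.span ℝ (b '' {i | (i : ℕ) < k})).starProjection - Γ.starProjection‖ ≤
      2 * ‖A - T‖ / σ := by
  set ε := ‖A - T‖
  have hε : 0 ≤ ε := norm_nonneg _
  have hσ0 : 0 < σ := by linarith
  have htop : ∀ i ∈ {i : Fin d | (i : ℕ) < k}, σ - ε ≤ l i := fun i hi =>
    le_eigenvalue_of_forall_mem_le b hl hb (Γ := Γ)
      (fun v hv => by linarith [hσ v hv, inner_sub_norm_mul_norm_sq_le (A := A) (T := T) v])
      (hk ▸ hi)
  have hfin : Module.finrank ℝ (Submodule.span ℝ (b '' {i | (i : ℕ) < k})) =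
      Module.finrank ℝ Γ := by
    have hset : {i : Fin d | (i : ℕ) < k} = (Finset.univ.filter fun i : Fin d => (i : ℕ) < k) := by
      simp
    have hkd : k ≤ d := by
      simpa [hk, Module.finrank_eq_card_basis b.toBasis] using Γ.finrank_le
    rw [hset, finrank_span_image_orthonormalBasis, Fin.card_filter_val_lt, min_eq_right hkd, hk]
  refine norm_starProjection_sub_le hfin (by positivity) ((div_lt_one hσ0).2 hlt) fun x hx => ?_
  have hAx : ‖A x‖ ≤ ε * ‖x‖ := by simpa [hT x hx] using (A - T).le_opNorm x
  have hGx := mul_norm_starProjection_le_norm_apply b hb (by linarith) htop x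
  rw [div_mul_eq_mul_div, le_div_iff₀ hσ0]
  nlinarith [norm_nonneg ((Submodule.span ℝ (b '' {i | (i : ℕ) < k})).starProjection x)]

end DavisKahan

/-! ### Nets and the operator norm -/

section Net

theorem packingNumber_sphere_le (E : Type*) [NormedAddCommGroup E] [NormedSpace ℝ E]
    [FiniteDimensional ℝ E] :
    Metric.packingNumber (1 / 2) (Metric.sphere (0 : E) 1) ≤ 5 ^ Module.finrank ℝ E := by
  classical
  refine iSup₂_le fun C hC => iSup_le fun hsep => ?_
  by_contra! hlt
  obtain ⟨t, htC, ht⟩ := Set.exists_subset_encard_eq (Order.add_one_le_of_lt hlt)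
  have hfin : t.Finite :=
    Set.finite_of_encard_eq_coe (k := 5 ^ Module.finrank ℝ E + 1) (by simp [ht])
  lift t to Finset E using hfin
  rw [Set.encard_coe_eq_coe_finsetCard] at ht
  have hcard : (t.image fun x => (2 : ℝ) • x).card ≤ 5 ^ Module.finrank ℝ E := by
    refine Besicovitch.card_le_of_separated _ ?_ ?_
    · intro c hc
      obtain ⟨x, hx, rfl⟩ := Finset.mem_image.1 hc
      simp [norm_smul, mem_sphere_zero_iff_norm.1 (hC (htC hx))]
    · intro c hc e he hne
      obtain ⟨x, hx, rfl⟩ := Finset.mem_image.1 hc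
      obtain ⟨y, hy, rfl⟩ := Finset.mem_image.1 he
      have hxy : ((1 / 2 : ℝ≥0) : ℝ≥0∞) < edist x y :=
        hsep (htC hx) (htC hy) fun h => hne (h ▸ rfl)
      rw [edist_nndist, ENNReal.coe_lt_coe, ← NNReal.coe_lt_coe, coe_nndist, dist_eq_norm,
        NNReal.coe_div, NNReal.coe_one, NNReal.coe_ofNat] at hxy
      rw [← smul_sub, norm_smul, Real.norm_two]
      linarith
  rw [Finset.card_image_of_injective _ (smul_right_injective E two_ne_zero)] at hcard
  have ht_nat : t.card = 5 ^ Module.finrank ℝ E + 1 := by exact_mod_cast ht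
  omega

theorem exists_finset_isCover_sphere (E : Type*) [NormedAddCommGroup E] [NormedSpace ℝ E]
    [FiniteDimensional ℝ E] :
    ∃ N : Finset E, N.card ≤ 5 ^ Module.finrank ℝ E ∧ (∀ y ∈ N, ‖y‖ = 1) ∧
      ∀ x : E, ‖x‖ = 1 → ∃ y ∈ N, ‖x - y‖ ≤ 1 / 2 := by
  have hne : Metric.packingNumber (1 / 2) (Metric.sphere (0 : E) 1) ≠ ⊤ :=
    ne_top_of_le_ne_top (by simp) (packingNumber_sphere_le E)
  set N := Metric.maximalSeparatedSet (1 / 2) (Metric.sphere (0 : E) 1)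
  have hcard : N.encard ≤ 5 ^ Module.finrank ℝ E :=
    (Metric.encard_maximalSeparatedSet hne).trans_le (packingNumber_sphere_le E)
  have hfin : N.Finite := Set.finite_of_encard_le_coe (k := 5 ^ Module.finrank ℝ E) (by simpa)
  refine ⟨hfin.toFinset, ?_, fun y hy => ?_, fun x hx => ?_⟩
  · rw [hfin.encard_eq_coe_toFinset_card] at hcard
    exact_mod_cast hcard
  · simpa using Metric.maximalSeparatedSet_subset (hfin.mem_toFinset.1 hy)
  · obtain ⟨y, hy, hxy⟩ := Metric.isCover_maximalSeparatedSet hne (mem_sphere_zero_iff_norm.2 hx)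
    refine ⟨y, hfin.mem_toFinset.2 hy, ?_⟩
    change edist x y ≤ ((1 / 2 : ℝ≥0) : ℝ≥0∞) at hxy
    rwa [edist_nndist, ENNReal.coe_le_coe, ← NNReal.coe_le_coe, coe_nndist, dist_eq_norm,
      NNReal.coe_div, NNReal.coe_one, NNReal.coe_ofNat] at hxy

variable {E : Type*} [NormedAddCommGroup E] [InnerProductSpace ℝ E]

theorem opNorm_le_of_abs_inner_self_le {T : E →L[ℝ] E} (hT : T.IsSymmetric) {c : ℝ} (hc : 0 ≤ c)
    (h : ∀ x, ‖x‖ = 1 → |⟪x, T x⟫| ≤ c) : ‖T‖ ≤ c := by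
  rw [T.norm_eq_iSup_rayleighQuotient hT]
  refine ciSup_le fun x => ?_
  rcases eq_or_ne x 0 with rfl | hx
  · rwa [T.rayleighQuotient_apply_zero, abs_zero]
  · have hunit : ‖(‖x‖⁻¹ • x)‖ = 1 := norm_smul_inv_norm hx
    have hle := h _ hunit
    rw [← T.rayleigh_smul x (inv_ne_zero (norm_ne_zero_iff.2 hx)),
      ContinuousLinearMap.rayleighQuotient, hunit, one_pow, div_one,
      ContinuousLinearMap.reApplyInnerSelf_apply]
    rwa [real_inner_comm] at hle

theorem abs_inner_self_sub_inner_self_le {T : E →L[ℝ] E} (hT : T.IsSymmetric) {x y : E}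
    (hx : ‖x‖ = 1) (hy : ‖y‖ = 1) (hxy : ‖x - y‖ ≤ 1 / 2) :
    |⟪x, T x⟫ - ⟪y, T y⟫| ≤ 31 / 32 * ‖T‖ := by
  have hsym : ⟪x, T y⟫ = ⟪y, T x⟫ := (hT x y).symm.trans (real_inner_comm _ _)
  have hpolar : ⟪x, T x⟫ - ⟪y, T y⟫ = ⟪x - y, T (x + y)⟫ := by
    rw [map_add, inner_sub_left, inner_add_right, inner_add_right, hsym]
    ring
  have hprod : ‖x - y‖ * ‖x + y‖ ≤ 31 / 32 := by
    have hpar := parallelogram_law_with_norm ℝ x y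
    have hsq : ‖x - y‖ ^ 2 ≤ 1 / 4 := by nlinarith [norm_nonneg (x - y)]
    have hadd : ‖x + y‖ ^ 2 = 4 - ‖x - y‖ ^ 2 := by
      rw [hx, hy] at hpar
      linarith
    refine le_of_sq_le_sq ?_ (by norm_num)
    rw [mul_pow, hadd]
    nlinarith [sq_nonneg ‖x - y‖]
  calc |⟪x, T x⟫ - ⟪y, T y⟫| ≤ ‖x - y‖ * ‖T (x + y)‖ := hpolar ▸ abs_real_inner_le_norm _ _
    _ ≤ ‖x - y‖ * (‖T‖ * ‖x + y‖) := by gcongr; exact T.le_opNorm _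
    _ = ‖x - y‖ * ‖x + y‖ * ‖T‖ := by ring
    _ ≤ 31 / 32 * ‖T‖ := by gcongr

theorem opNorm_le_of_net {T : E →L[ℝ] E} (hT : T.IsSymmetric) {N : Finset E}
    (hN1 : ∀ y ∈ N, ‖y‖ = 1) (hN : ∀ x : E, ‖x‖ = 1 → ∃ y ∈ N, ‖x - y‖ ≤ 1 / 2) {r : ℝ}
    (hr : 0 ≤ r) (h : ∀ y ∈ N, |⟪y, T y⟫| ≤ r) : ‖T‖ ≤ 32 * r := by
  have hself : ‖T‖ ≤ r + 31 / 32 * ‖T‖ := by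
    refine opNorm_le_of_abs_inner_self_le hT (by positivity) fun x hx => ?_
    obtain ⟨y, hy, hxy⟩ := hN x hx
    have hdiff := abs_inner_self_sub_inner_self_le hT hx (hN1 y hy) hxy
    calc |⟪x, T x⟫| ≤ |⟪y, T y⟫| + |⟪x, T x⟫ - ⟪y, T y⟫| := by
          simpa using abs_add_le ⟪y, T y⟫ (⟪x, T x⟫ - ⟪y, T y⟫)
      _ ≤ r + 31 / 32 * ‖T‖ := add_le_add (h y hy) hdiff
  linarith

theorem measureReal_lt_opNorm_le [FiniteDimensional ℝ E] {Ω : Type*} [MeasurableSpace Ω]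
    {P : Measure Ω} [IsFiniteMeasure P] {T : Ω → E →L[ℝ] E} (hT : ∀ ω, (T ω).IsSymmetric)
    {r p : ℝ} (hr : 0 ≤ r) (hp : 0 ≤ p)
    (h : ∀ u : E, ‖u‖ = 1 → P.real {ω | r < |⟪u, T ω u⟫|} ≤ p) :
    P.real {ω | 32 * r < ‖T ω‖} ≤ 5 ^ Module.finrank ℝ E * p := by
  obtain ⟨N, hcard, hN1, hN⟩ := exists_finset_isCover_sphere E
  have hsub : {ω | 32 * r < ‖T ω‖} ⊆ ⋃ y ∈ N, {ω | r < |⟪y, T ω y⟫|} := by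
    intro ω hω
    simp only [Set.mem_iUnion, Set.mem_ofPred_eq]
    by_contra! hle
    exact (opNorm_le_of_net (hT ω) hN1 hN hr hle).not_gt hω
  calc P.real {ω | 32 * r < ‖T ω‖}
      ≤ P.real (⋃ y ∈ N, {ω | r < |⟪y, T ω y⟫|}) := measureReal_mono hsub (measure_ne_top P _)
    _ ≤ ∑ y ∈ N, P.real {ω | r < |⟪y, T ω y⟫|} := measureReal_biUnion_finset_le _ _
    _ ≤ ∑ _y ∈ N, p := Finset.sum_le_sum fun y hy => h y (hN1 y hy)
    _ = N.card * p := by rw [Finset.sum_const, nsmul_eq_mul]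
    _ ≤ 5 ^ Module.finrank ℝ E * p := by gcongr; exact_mod_cast hcard

end Net

/-! ### The estimator -/

section Matrices

variable {n d : ℕ}

/-- A `d × d` matrix as an operator on Euclidean space, so that `specNorm M = ‖op M‖`. -/
noncomputable abbrev op (M : Matrix (Fin d) (Fin d) ℝ) :
    EuclideanSpace ℝ (Fin d) →L[ℝ] EuclideanSpace ℝ (Fin d) :=
  Matrix.toEuclideanCLM (n := Fin d) (𝕜 := ℝ) M

theorem op_isSymmetric {M : Matrix (Fin d) (Fin d) ℝ} (hM : M.IsHermitian) :
    (op M).IsSymmetric := Matrix.isSymmetric_toEuclideanLin_iff.2 hM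

theorem op_outer_apply (x y v : EuclideanSpace ℝ (Fin d)) : op (outer x y) v = ⟪y, v⟫ • x := by
  ext i
  simp [outer, Matrix.vecMulVec_mulVec, PiLp.inner_apply, dotProduct, mul_comm]

theorem isHermitian_sum_outer (w : Fin n → ℝ) (μ : Fin n → EuclideanSpace ℝ (Fin d)) :
    (∑ i, w i • outer (μ i) (μ i)).IsHermitian := by
  ext i j
  simp [Matrix.sum_apply, outer, Matrix.vecMulVec_apply, mul_comm]

theorem op_sum_outer_apply (w : Fin n → ℝ) (μ : Fin n → EuclideanSpace ℝ (Fin d))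
    (v : EuclideanSpace ℝ (Fin d)) :
    op (∑ i, w i • outer (μ i) (μ i)) v = ∑ i, (w i * ⟪μ i, v⟫) • μ i := by
  simp only [op, map_sum, map_smul, sum_apply, smul_apply, op_outer_apply, smul_smul]

theorem inner_op_sum_outer (w : Fin n → ℝ) (μ : Fin n → EuclideanSpace ℝ (Fin d))
    (v : EuclideanSpace ℝ (Fin d)) :
    ⟪v, op (∑ i, w i • outer (μ i) (μ i)) v⟫ = ∑ i, w i * ⟪v, μ i⟫ ^ 2 := by
  rw [op_sum_outer_apply, inner_sum]
  refine Finset.sum_congr rfl fun i _ => ?_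
  rw [real_inner_smul_right, real_inner_comm v]
  ring

theorem sum_mul_inner_sq_le_specNorm (w : Fin n → ℝ) (μ : Fin n → EuclideanSpace ℝ (Fin d))
    {u : EuclideanSpace ℝ (Fin d)} (hu : ‖u‖ = 1) :
    ∑ i, w i * ⟪u, μ i⟫ ^ 2 ≤ specNorm (∑ i, w i • outer (μ i) (μ i)) := by
  set M := ∑ i, w i • outer (μ i) (μ i)
  calc ∑ i, w i * ⟪u, μ i⟫ ^ 2 = ⟪u, op M u⟫ := (inner_op_sum_outer w μ u).symm
    _ ≤ ‖u‖ * ‖op M u‖ := real_inner_le_norm _ _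
    _ ≤ ‖u‖ * (‖op M‖ * ‖u‖) := by gcongr; exact (op M).le_opNorm u
    _ = specNorm M := by rw [hu, one_mul, mul_one, specNorm]

end Matrices

section TopEigenspace

variable {d k : ℕ}

theorem exists_eigenbasis_of_kthEigenvalue_pos {M : Matrix (Fin d) (Fin d) ℝ}
    (h : 0 < kthEigenvalue M k) :
    ∃ (b : OrthonormalBasis (Fin d) ℝ (EuclideanSpace ℝ (Fin d))) (l : Fin d → ℝ) (i : Fin d),
      Antitone l ∧ (∀ j, op M (b j) = l j • b j) ∧ (i : ℕ) + 1 = k ∧ l i = kthEigenvalue M k := by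
  have hM : M.IsHermitian ∧ 1 ≤ k ∧ k ≤ d := by
    by_contra hM
    exact h.ne' (dif_neg hM)
  have hs := Matrix.isSymmetric_toEuclideanLin_iff.2 hM.1
  exact ⟨hs.eigenvectorBasis finrank_euclideanSpace_fin, hs.eigenvalues finrank_euclideanSpace_fin,
    ⟨k - 1, by omega⟩, hs.eigenvalues_antitone finrank_euclideanSpace_fin,
    hs.apply_eigenvectorBasis finrank_euclideanSpace_fin, Nat.sub_add_cancel hM.2.1,
    by rw [kthEigenvalue, dif_pos hM]⟩

theorem kthEigenvalue_mul_norm_sq_le {M : Matrix (Fin d) (Fin d) ℝ}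
    {Γ : Submodule ℝ (EuclideanSpace ℝ (Fin d))} (hM : ∀ v, op M v ∈ Γ)
    (hΓ : Module.finrank ℝ Γ = k) (h : 0 < kthEigenvalue M k) {v : EuclideanSpace ℝ (Fin d)}
    (hv : v ∈ Γ) : kthEigenvalue M k * ‖v‖ ^ 2 ≤ ⟪v, op M v⟫ := by
  obtain ⟨b, l, i, hl, hb, hi, hli⟩ := exists_eigenbasis_of_kthEigenvalue_pos h
  rw [← hli] at h ⊢
  exact eigenvalue_mul_norm_sq_le b hl hb hM h (hΓ.trans hi.symm) hv

theorem sin_maxPrincipalAngle_le {G H : Submodule ℝ (EuclideanSpace ℝ (Fin d))} {s : ℝ}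
    (h : s < 1 → ‖G.starProjection - H.starProjection‖ ≤ s) :
    Real.sin (maxPrincipalAngle G H) ≤ s := by
  rcases lt_or_ge s 1 with hs | hs
  · rw [maxPrincipalAngle, Real.sin_arcsin (neg_one_lt_zero.le.trans (norm_nonneg _))
      ((h hs).trans hs.le)]
    exact h hs
  · exact (Real.sin_le_one _).trans hs

theorem sin_maxPrincipalAngle_le_of_isTopEigenspace {n : ℕ} {w : Fin n → ℝ}
    {μ : Fin n → EuclideanSpace ℝ (Fin d)}
    (hk : Module.finrank ℝ (Submodule.span ℝ (Set.range μ)) = k) (hσ : 0 < sigmaSq w μ k)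
    {A : Matrix (Fin d) (Fin d) ℝ} {G : Submodule ℝ (EuclideanSpace ℝ (Fin d))}
    (hG : IsTopEigenspace A k G) :
    Real.sin (maxPrincipalAngle G (Submodule.span ℝ (Set.range μ))) ≤
      2 * ‖op A - op (∑ i, w i • outer (μ i) (μ i))‖ / sigmaSq w μ k := by
  obtain ⟨b, l, hl, hb, rfl⟩ := hG
  have hμ : ∀ i, μ i ∈ Submodule.span ℝ (Set.range μ) := fun i => Submodule.subset_span ⟨i, rfl⟩
  refine sin_maxPrincipalAngle_le fun hlt => norm_starProjection_span_sub_le b hl hb hk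
    (fun v hv => ?_) (fun v hv => kthEigenvalue_mul_norm_sq_le (fun v => ?_) hk hσ hv)
    ((div_lt_one hσ).1 hlt)
  · rw [op_sum_outer_apply]
    exact Finset.sum_eq_zero fun i _ => by
      rw [Submodule.inner_right_of_mem_orthogonal (hμ i) hv, mul_zero, zero_smul]
  · rw [op_sum_outer_apply]
    exact Submodule.sum_mem _ fun i _ => Submodule.smul_mem _ _ (hμ i)

end TopEigenspace

section Deviation

variable {n d : ℕ} {m : Fin n → ℕ} {w η : Fin n → ℝ}

theorem isHermitian_estMatrix (m : Fin n → ℕ) (w : Fin n → ℝ)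
    (x : (i : Fin n) → Fin (m i) → EuclideanSpace ℝ (Fin d)) : (estMatrix m w x).IsHermitian := by
  ext a b
  simp only [estMatrix, Matrix.conjTranspose_apply, star_trivial, Matrix.sum_apply,
    Matrix.smul_apply, outer, Matrix.vecMulVec_apply]
  refine Finset.sum_congr rfl fun i _ => congrArg _ ?_
  refine Finset.sum_equiv (Equiv.prodComm _ _) (fun p => ?_) fun p _ => mul_comm _ _
  simp [ne_comm]

theorem inner_op_estMatrix (m : Fin n → ℕ) (w : Fin n → ℝ)
    (x : (i : Fin n) → Fin (m i) → EuclideanSpace ℝ (Fin d)) (u : EuclideanSpace ℝ (Fin d)) :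
    ⟪u, op (estMatrix m w x) u⟫ = ∑ i, w i / (m i * (m i - 1)) *
      ∑ p ∈ (Finset.univ : Finset (Fin (m i))).offDiag, ⟪u, x i p.1⟫ * ⟪u, x i p.2⟫ := by
  simp only [op, estMatrix, map_sum, map_smul, sum_apply, smul_apply, op_outer_apply, inner_sum,
    inner_smul_right]
  simp only [real_inner_comm u, mul_comm]

theorem inner_op_estMatrix_sub (hm : ∀ i, 2 ≤ m i) (w : Fin n → ℝ)
    (μ : Fin n → EuclideanSpace ℝ (Fin d)) (z : (i : Fin n) → Fin (m i) → EuclideanSpace ℝ (Fin d))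
    (u : EuclideanSpace ℝ (Fin d)) :
    ⟪u, (op (estMatrix m w fun i j => μ i + z i j) - op (∑ i, w i • outer (μ i) (μ i))) u⟫ =
      ∑ i, (2 * w i * ⟪u, μ i⟫ / m i * ∑ j, ⟪u, z i j⟫ + w i / (m i * (m i - 1)) *
        ∑ p ∈ (Finset.univ : Finset (Fin (m i))).offDiag, ⟪u, z i p.1⟫ * ⟪u, z i p.2⟫) := by
  rw [sub_apply, inner_sub_right, inner_op_estMatrix, inner_op_sum_outer, ← Finset.sum_sub_distrib]
  refine Finset.sum_congr rfl fun i _ => ?_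
  have hmi : (2 : ℝ) ≤ m i := by exact_mod_cast hm i
  have hm0 : (m i : ℝ) ≠ 0 := by linarith
  have hm1 : (m i : ℝ) - 1 ≠ 0 := by linarith
  rw [sum_offDiag_mul fun j => ⟪u, μ i + z i j⟫, sum_offDiag_mul fun j => ⟪u, z i j⟫]
  simp only [inner_add_right, add_sq, Finset.sum_add_distrib, Finset.sum_const, Finset.card_univ,
    Fintype.card_fin, nsmul_eq_mul, ← Finset.mul_sum]
  field_simp
  ring

variable {Ω : Type*} [MeasurableSpace Ω] {P : Measure Ω}

theorem IsSubGaussianVec.integrable {Y : Ω → EuclideanSpace ℝ (Fin d)} {b : ℝ}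
    (h : IsSubGaussianVec P Y b) : Integrable Y P := by
  let B := EuclideanSpace.basisFun (Fin d) ℝ
  have hsum : Y = fun ω => ∑ i, ⟪B i, Y ω⟫ • B i := funext fun ω => (B.sum_repr' (Y ω)).symm
  rw [hsum]
  exact integrable_finsetSum _ fun i _ => ((h (B i) (B.norm_eq_one i)).1).smul_const _

theorem offDiag_scale_le {m w : ℝ} (hm : 2 ≤ m) (hw : 0 ≤ w) (η : ℝ) :
    480 * (w / (m * (m - 1))) * m * (6 * η ^ 2) ≤ 5760 * (w * η ^ 2 / m) :=
  calc 480 * (w / (m * (m - 1))) * m * (6 * η ^ 2) = 2880 * (w * η ^ 2) / (m - 1) := by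
        have hm0 : m ≠ 0 := by positivity
        have hm1 : m - 1 ≠ 0 := by linarith
        field
    _ ≤ 2880 * (w * η ^ 2) / (m / 2) := by gcongr; linarith
    _ = 5760 * (w * η ^ 2 / m) := by ring

theorem block_variance_le {m w : ℝ} (hm : 2 ≤ m) (hw : 0 ≤ w) (η α : ℝ) :
    10 * m * (6 * η ^ 2) * (2 * w * α / m) ^ 2 +
        4 * (480 * (w / (m * (m - 1))) * m * (6 * η ^ 2)) ^ 2 ≤
      11520 ^ 2 * (w ^ 2 * η ^ 2 / m * α ^ 2 + w ^ 2 * η ^ 4 / m ^ 2) := by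
  have hm1 : 0 ≤ m - 1 := by linarith
  have hlin : 10 * m * (6 * η ^ 2) * (2 * w * α / m) ^ 2 = 240 * (w ^ 2 * η ^ 2 / m * α ^ 2) := by
    field
  have hquad := pow_le_pow_left₀ (by positivity) (offDiag_scale_le hm hw η) 2
  have hα : 0 ≤ w ^ 2 * η ^ 2 / m * α ^ 2 := by positivity
  have hsq : (5760 * (w * η ^ 2 / m)) ^ 2 = 5760 ^ 2 * (w ^ 2 * η ^ 4 / m ^ 2) := by ring
  linarith

variable [IsProbabilityMeasure P] {z : (i : Fin n) → Fin (m i) → Ω → EuclideanSpace ℝ (Fin d)}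
  {D R : ℝ} {u : EuclideanSpace ℝ (Fin d)}

theorem hasSubexponentialMGF_inner_op_estMatrix_sub (hm : ∀ i, 2 ≤ m i) (hw : ∀ i, 0 ≤ w i)
    (μ : Fin n → EuclideanSpace ℝ (Fin d)) (hz : ∀ i j, Measurable (z i j))
    (hind : iIndepFun (fun p : (i : Fin n) × Fin (m i) => z p.1 p.2) P)
    (h0 : ∀ i j, ∫ ω, z i j ω ∂P = 0) (hsg : ∀ i j, IsSubGaussianVec P (z i j) (η i))
    (hR : ∀ i, w i * η i ^ 2 / m i ≤ R) (hu : ‖u‖ = 1) :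
    HasSubexponentialMGF P
      (fun ω => ⟪u, (op (estMatrix m w fun i j => μ i + z i j ω) -
        op (∑ i, w i • outer (μ i) (μ i))) u⟫)
      (11520 ^ 2 * (xiSq m w η μ + ∑ i, w i ^ 2 * η i ^ 4 / (m i : ℝ) ^ 2)) (5760 * R) := by
  have hm2 : ∀ i, (2 : ℝ) ≤ m i := fun i => by exact_mod_cast hm i
  have : ∀ i, NeZero (m i) := fun i => ⟨by linarith [hm i]⟩
  have hmean : ∀ i j, ∫ ω, ⟪u, z i j ω⟫ ∂P = 0 := fun i j => by
    rw [integral_inner (hsg i j).integrable, h0, inner_zero_right]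
  have hc0 : ∀ i, 0 ≤ w i / (m i * (m i - 1)) := fun i =>
    div_nonneg (hw i) (mul_nonneg (by positivity) (by linarith [hm2 i]))
  have ha : ∀ i, ((6 * ‖η i‖₊ ^ 2 : ℝ≥0) : ℝ) = 6 * η i ^ 2 := fun i => by simp
  have hscale : ∀ i, 480 * |w i / (m i * (m i - 1))| * Fintype.card (Fin (m i)) *
      (6 * ‖η i‖₊ ^ 2 : ℝ≥0) ≤ 5760 * R := fun i => by
    rw [abs_of_nonneg (hc0 i), Fintype.card_fin, ha]
    exact (offDiag_scale_le (hm2 i) (hw i) _).trans (by gcongr; exact hR i)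
  simp only [inner_op_estMatrix_sub hm]
  refine (hasSubexponentialMGF_sum_blocks (fun i j => (hz i j).const_inner)
    (hind.comp (fun _ v => ⟪u, v⟫) fun _ => by fun_prop) hmean
    (fun i j => (hsg i j u hu).hasSubgaussianMoments (hmean i j))
    (fun i => 2 * w i * ⟪u, μ i⟫ / m i) _ hscale).mono ?_ le_rfl
  simp only [Fintype.card_fin, ha]
  calc _ ≤ ∑ i, 11520 ^ 2 * (w i ^ 2 * η i ^ 2 / m i * ⟪u, μ i⟫ ^ 2 +
          w i ^ 2 * η i ^ 4 / (m i : ℝ) ^ 2) :=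
        Finset.sum_le_sum fun i _ => block_variance_le (hm2 i) (hw i) _ _
    _ = 11520 ^ 2 * (∑ i, w i ^ 2 * η i ^ 2 / m i * ⟪u, μ i⟫ ^ 2 +
          ∑ i, w i ^ 2 * η i ^ 4 / (m i : ℝ) ^ 2) := by
        rw [← Finset.mul_sum, Finset.sum_add_distrib]
    _ ≤ _ := by gcongr; exact sum_mul_inner_sq_le_specNorm _ μ hu

theorem measureReal_lt_abs_inner_op_estMatrix_sub_le (hm : ∀ i, 2 ≤ m i) (hw : ∀ i, 0 ≤ w i)
    (μ : Fin n → EuclideanSpace ℝ (Fin d)) (hz : ∀ i j, Measurable (z i j))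
    (hind : iIndepFun (fun p : (i : Fin n) × Fin (m i) => z p.1 p.2) P)
    (h0 : ∀ i j, ∫ ω, z i j ω ∂P = 0) (hsg : ∀ i j, IsSubGaussianVec P (z i j) (η i))
    (hR : ∀ i, w i * η i ^ 2 / m i ≤ R) (hR0 : 0 ≤ R) (hD : 0 < D) (hu : ‖u‖ = 1) :
    P.real {ω | 46080 * (√(D * (xiSq m w η μ + ∑ i, w i ^ 2 * η i ^ 4 / (m i : ℝ) ^ 2)) + D * R) <
      |⟪u, (op (estMatrix m w fun i j => μ i + z i j ω) -
        op (∑ i, w i • outer (μ i) (μ i))) u⟫|} ≤ 2 * Real.exp (-(2 * D)) := by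
  set V := xiSq m w η μ + ∑ i, w i ^ 2 * η i ^ 4 / (m i : ℝ) ^ 2
  have hV : 0 ≤ V := add_nonneg (norm_nonneg _) (Finset.sum_nonneg fun i _ => by positivity)
  have hsqrt : √(2 * D * (11520 ^ 2 * V)) ≤ 23040 * √(D * V) := by
    rw [Real.sqrt_le_left (by positivity), mul_pow, Real.sq_sqrt (by positivity)]
    linarith [show 0 ≤ D * V by positivity]
  have hthreshold : 2 * √(2 * D * (11520 ^ 2 * V)) + 2 * (2 * D * (5760 * R)) ≤
      46080 * (√(D * V) + D * R) := by
    linarith [show 0 ≤ D * R by positivity]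
  have hmgf := hasSubexponentialMGF_inner_op_estMatrix_sub hm hw μ hz hind h0 hsg hR hu
  exact (measureReal_mono fun ω hω => hthreshold.trans_lt hω).trans
    (hmgf.measureReal_lt_abs_le (by positivity) (by positivity) (by positivity))

theorem five_pow_mul_two_mul_exp_le {δ : ℝ} (hδ : 0 < δ) (hδ2 : δ ≤ 1 / 2) (d : ℕ) :
    5 ^ d * (2 * Real.exp (-(2 * (d + Real.log (1 / δ))))) ≤ δ := by
  have hfive : (5 : ℝ) ≤ Real.exp 2 := by
    rw [show (2 : ℝ) = 1 + 1 by norm_num, Real.exp_add]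
    nlinarith [Real.exp_one_gt_d9]
  have hexp : Real.exp (-(2 * (d + Real.log (1 / δ)))) = (Real.exp 2 ^ d)⁻¹ * δ ^ 2 := by
    have hsplit : -(2 * (d + Real.log (1 / δ))) = -(d * 2) + Real.log (δ ^ 2) := by
      rw [one_div, Real.log_inv, Real.log_pow]
      push_cast
      ring
    rw [hsplit, Real.exp_add, Real.exp_neg, Real.exp_nat_mul, Real.exp_log (by positivity)]
  calc 5 ^ d * (2 * Real.exp (-(2 * (d + Real.log (1 / δ)))))
      ≤ Real.exp 2 ^ d * (2 * Real.exp (-(2 * (d + Real.log (1 / δ))))) := by gcongr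
    _ = 2 * δ ^ 2 := by rw [hexp]; field
    _ ≤ δ := by nlinarith

theorem measureReal_lt_norm_op_estMatrix_sub_le (hm : ∀ i, 2 ≤ m i) (hw : ∀ i, 0 ≤ w i)
    (μ : Fin n → EuclideanSpace ℝ (Fin d)) (hz : ∀ i j, Measurable (z i j))
    (hind : iIndepFun (fun p : (i : Fin n) × Fin (m i) => z p.1 p.2) P)
    (h0 : ∀ i j, ∫ ω, z i j ω ∂P = 0) (hsg : ∀ i j, IsSubGaussianVec P (z i j) (η i))
    {δ : ℝ} (hδ : 0 < δ) (hδ2 : δ ≤ 1 / 2) :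
    P.real {ω | 32 * (46080 * (√((d + Real.log (1 / δ)) *
        (xiSq m w η μ + ∑ i, w i ^ 2 * η i ^ 4 / (m i : ℝ) ^ 2)) +
        (d + Real.log (1 / δ)) * ⨆ i, w i * η i ^ 2 / m i)) <
      ‖op (estMatrix m w fun i j => μ i + z i j ω) -
        op (∑ i, w i • outer (μ i) (μ i))‖} ≤ δ := by
  have hlog : 0 < Real.log (1 / δ) := Real.log_pos (by rw [lt_div_iff₀ hδ]; linarith)
  have hR : ∀ i, w i * η i ^ 2 / m i ≤ ⨆ i, w i * η i ^ 2 / m i :=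
    le_ciSup (Set.finite_range fun i => w i * η i ^ 2 / (m i : ℝ)).bddAbove
  have hR0 : 0 ≤ ⨆ i, w i * η i ^ 2 / (m i : ℝ) := Real.iSup_nonneg fun i =>
    div_nonneg (mul_nonneg (hw i) (sq_nonneg _)) (Nat.cast_nonneg _)
  have hsymm : ∀ ω, (op (estMatrix m w fun i j => μ i + z i j ω) -
      op (∑ i, w i • outer (μ i) (μ i))).IsSymmetric := fun ω => by
    rw [op, op, ← map_sub]
    exact op_isSymmetric ((isHermitian_estMatrix m w _).sub (isHermitian_sum_outer w μ))
  refine (measureReal_lt_opNorm_le hsymm (by positivity) (by positivity) fun u hu =>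
    measureReal_lt_abs_inner_op_estMatrix_sub_le hm hw μ hz hind h0 hsg hR hR0 (by positivity)
      hu).trans ?_
  rw [finrank_euclideanSpace_fin]
  exact five_pow_mul_two_mul_exp_le hδ hδ2 d

theorem exists_measurableSet_of_measureReal_compl_le {s : Set Ω} {δ : ℝ} (h : P.real sᶜ ≤ δ) :
    ∃ t, MeasurableSet t ∧ ENNReal.ofReal (1 - δ) ≤ P t ∧ t ⊆ s := by
  have hmeas := measurableSet_toMeasurable P sᶜ
  refine ⟨(toMeasurable P sᶜ)ᶜ, hmeas.compl, ?_,
    Set.compl_subset_comm.1 (subset_toMeasurable P sᶜ)⟩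
  rw [← ofReal_measureReal, probReal_compl_eq_one_sub hmeas, measureReal_def, measure_toMeasurable]
  exact ENNReal.ofReal_le_ofReal (sub_le_sub_left h 1)

end Deviation

end HeteroPCA

open HeteroPCA in
theorem theorem3p1 :
    ∃ C : ℝ, 0 < C ∧
      ∀ (n d k : ℕ) (m : Fin n → ℕ) (w η : Fin n → ℝ)
        (μ : Fin n → EuclideanSpace ℝ (Fin d))
        (Ω : Type*) [MeasurableSpace Ω] (P : Measure Ω) [IsProbabilityMeasure P]
        (z : (i : Fin n) → Fin (m i) → Ω → EuclideanSpace ℝ (Fin d)) (δ : ℝ),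
        (∀ i, 2 ≤ m i) → (∀ i, 0 ≤ w i) → (∀ i, 0 ≤ η i) →
        1 ≤ k → Module.finrank ℝ (Submodule.span ℝ (Set.range μ)) = k →
        0 < HeteroPCA.sigmaSq w μ k →
        (∀ i j, Measurable (z i j)) →
        iIndepFun (fun p : (i : Fin n) × Fin (m i) => z p.1 p.2) P →
        (∀ i j, ∫ ω, z i j ω ∂P = 0) →
        (∀ i j, HeteroPCA.IsSubGaussianVec P (z i j) (η i)) →
        0 < δ → δ < 1 / 2 →
        ∃ E : Set Ω, MeasurableSet E ∧ ENNReal.ofReal (1 - δ) ≤ P E ∧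
          ∀ ω ∈ E, ∀ Γhat : Submodule ℝ (EuclideanSpace ℝ (Fin d)),
            HeteroPCA.IsTopEigenspace
              (HeteroPCA.estMatrix m w (fun i j => μ i + z i j ω)) k Γhat →
            Real.sin (HeteroPCA.maxPrincipalAngle Γhat (Submodule.span ℝ (Set.range μ))) ≤
              C * ((HeteroPCA.sigmaSq w μ k)⁻¹ *
                    √(((d : ℝ) + Real.log (1 / δ)) *
                      (HeteroPCA.xiSq m w η μ + ∑ i, w i ^ 2 * η i ^ 4 / (m i : ℝ) ^ 2))
                  + (HeteroPCA.sigmaSq w μ k)⁻¹ * ((d : ℝ) + Real.log (1 / δ)) *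
                    ⨆ i, w i * η i ^ 2 / (m i : ℝ)) := by
  refine ⟨64 * 46080, by norm_num, ?_⟩
  intro n d k m w η μ Ω _ P _ z δ hm hw _ _ hk hσ hz hind h0 hsg hδ hδ2
  have hdev := measureReal_lt_norm_op_estMatrix_sub_le hm hw μ hz hind h0 hsg hδ hδ2.le
  set D := d + Real.log (1 / δ)
  set V := xiSq m w η μ + ∑ i, w i ^ 2 * η i ^ 4 / (m i : ℝ) ^ 2
  set R := ⨆ i, w i * η i ^ 2 / (m i : ℝ)
  obtain ⟨E, hE, hPE, hEdev⟩ := exists_measurableSet_of_measureReal_compl_le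
    (s := {ω | ‖op (estMatrix m w fun i j => μ i + z i j ω) - op (∑ i, w i • outer (μ i) (μ i))‖ ≤
      32 * (46080 * (√(D * V) + D * R))}) (by simpa only [Set.compl_ofPred, not_le] using hdev)
  refine ⟨E, hE, hPE, fun ω hω Γhat hΓhat => ?_⟩
  calc Real.sin (maxPrincipalAngle Γhat (Submodule.span ℝ (Set.range μ)))
      ≤ 2 * ‖op (estMatrix m w fun i j => μ i + z i j ω) - op (∑ i, w i • outer (μ i) (μ i))‖ /
          sigmaSq w μ k := sin_maxPrincipalAngle_le_of_isTopEigenspace hk hσ hΓhat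
    _ ≤ 2 * (32 * (46080 * (√(D * V) + D * R))) / sigmaSq w μ k := by gcongr; exact hEdev hω
    _ = 64 * 46080 * ((sigmaSq w μ k)⁻¹ * √(D * V) + (sigmaSq w μ k)⁻¹ * D * R) := by ring
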